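/- **Setting.** Let $\Omega\subset\mathbb R^D$ carry a metric $\mathsf d$ with open balls $B(x,r)=\{y\in\Omega:\mathsf d(x,y)<r\}$ and a Borel measure $\mathsf m$ (for instance Lebesgue measure, or surface measure if $\Omega$ is an algebraic surface) such that all balls are measurable, $\mathsf m(B(x,2r))\le c\,\mathsf m(B(x,r))$ for all $x\in\Omega$, $r>0$, and $\inf_{x}\mathsf m(B(x,\varepsilon))>0$ for every $\varepsilon>0$. For a function $\mathsf w\ge 0$ put $\mathsf w(E)=\int_E \mathsf w\,d\mathsf m$. A *doubling weight* is a nonnegative integrable function $\mathsf w$ on $\Omega$ with $\mathsf w(\Omega)>0$ for which there is $L>0$ with $\mathsf w(B(x,2r))\le L\,\mathsf w(B(x,r))$ for all $x\in\Omega$, $r>0$. Let $\Pi_n(\Omega)$ be the space of restrictions to $\Omega$ of real polynomials in $D$ variables of total degree at most $n$. **Localizability.** Let $\varpi$ be a doubling weight with $\int_\Omega\varpi\,d\mathsf m=1$ such that $\langle f,g\rangle_\varpi=\int_\Omega fg\varpi\,d\mathsf m$ is a well defined inner product on $\Pi_n(\Omega)$ for every $n$. Let $\mathcal V_k$ be the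 space of those $f\in\Pi_k(\Omega)$ that are orthogonal to $\Pi_j(\Omega)$ for all $j<k$, let $P_k(\cdot,\cdot)$ be its reproducing kernel, and let $L_n(x,y)=\sum_{k\ge0}\widehat a(k/n)P_k(x,y)$, where $\widehat a$ is a nonnegative $C^\infty$ function on $[0,\infty)$ with support in $[0,2]$ and $\widehat a=1$ on $[0,1]$. Assume that $(\Omega,\varpi,\mathsf d)$ is localizable with these kernels, that is: 1. for every $\kappa>0$ there is $c_\kappa$ such that for all $n\ge1$ and $x,y\in\Omega$ $$|L_n(x,y)|\le \frac{c_\kappa}{\sqrt{\varpi(B(x,\frac1n))}\sqrt{\varpi(B(y,\frac1n))}\,(1+n\mathsf d(x,y))^{\kappa}};$$ 2. there is $\delta_*\in(0,1)$, and for every $\kappa>0$ a constant $c_\kappa$, such that for all $n\ge1$, $0<\delta\le\delta_*$, $x_2,y\in\Omega$ and $x_1\in B(x_2,\frac\delta n)$ $$|L_n(x_1,y)-L_n(x_2,y)|\le \frac{c_\kappa\, n\,\mathsf d(x_1,x_2)}{\sqrt{\varpi(B(x_1,\frac1n))}\sqrt{\varpi(B(x_2,\frac1n))}\,(1+n\mathsf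 d(x_2,y))^{\kappa}};$$ 3. for all sufficiently large $\kappa$ there is $c$ such that for all $n\ge1$ and $x\in\Omega$ $$\int_\Omega \frac{\varpi(y)}{\varpi(B(y,\frac1n))(1+n\mathsf d(x,y))^{\kappa}}\,d\mathsf m(y)\le c .$$ **Assertion 4** is the statement that $\Omega$ is compact and, for every $\gamma>1$, there are constants $\delta',c,c_1',c_2'>0$ and an integer $r\ge1$ such that for every $n\ge1$ there are polynomials $T_x\in\Pi_n(\Omega)$ $(x\in\Omega)$ and a polynomial $q_n$ with: $T_x(x)=1$; $T_x(y)\ge\delta'$ for $y\in B(x,\frac1n)$; $0\le T_x(y)\le c(1+n\mathsf d(x,y))^{-\gamma}$ for $y\in\Omega$; $c_1'\le q_n\le c_2'$ on $\Omega$; and $x\mapsto q_n(x)T_x(y)$ belongs to $\Pi_{rn}(\Omega)$ for every $y\in\Omega$. A set $\Xi\subset\Omega$ is *maximal $\varepsilon$-separated* if $\mathsf d(x,y)\ge\varepsilon$ for distinct $x,y\in\Xi$ and, for some constant $c_d>1$, $1\le\sum_{z\in\Xi}\chi_{B(z,\varepsilon)}(x)\le c_d$ for all $x\in\Omega$. **Theorem.**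 Let $\mathsf w$ be a doubling weight on $\Omega$. There are constants $\delta_0,c_1,c_2>0$ such that for every integer $n\ge1$, every $0<\delta<\delta_0$ and every maximal $\frac\delta n$-separated set $\Xi\subset\Omega$ the following holds: $\Xi$ is finite, and there are numbers $\lambda_z>0$, $z\in\Xi$, such that, for every $f\in\Pi_n(\Omega)$, $f\mathsf w$ is integrable and $$\int_\Omega f(x)\mathsf w(x)\,d\mathsf m(x)=\sum_{z\in\Xi}\lambda_z f(z),$$ and $\lambda_z\ge c_1\,\mathsf w(B(z,\tfrac\delta n))$ for all $z\in\Xi$; if moreover Assertion 4 holds, then also $\lambda_z\le c_2\,\mathsf w(B(z,\tfrac\delta n))$ for all $z\in\Xi$. -/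

import Mathlib

open MeasureTheory Set
open scoped ContDiff ENNReal NNReal

namespace LocHom

noncomputable section

/-! Throughout, `Ω` is a subset of `ℝ^D`, `ρ` is a distance on `Ω` (unrelated a priori to the
Euclidean one), and `m` is the reference measure on the Borel sets of `Ω`
(Lebesgue measure for solid domains, surface measure for algebraic surfaces). -/

/-- The open ball `B(x,r) = {y ∈ Ω : d(x,y) < r}`. -/
def dBall {D : ℕ} {Ω : Set (Fin D → ℝ)} (ρ : MetricSpace Ω) (x : Ω) (r : ℝ) : Set Ω :=
  {y | ρ.dist x y < r}

/-- `w(E) = ∫_E w dm`. -/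
def wMass {D : ℕ} {Ω : Set (Fin D → ℝ)} (m : Measure Ω) (w : Ω → ℝ) (E : Set Ω) : ℝ :=
  ∫ x in E, w x ∂m

/-- The standing assumptions on `(Ω, m, d)`: the balls are measurable, `m` is a doubling measure,
and balls of a given radius have measure bounded away from zero. -/
structure IsHomogeneousDomain {D : ℕ} {Ω : Set (Fin D → ℝ)} (ρ : MetricSpace Ω)
    (m : Measure Ω) : Prop where
  measurableSet_ball : ∀ (x : Ω) (r : ℝ), MeasurableSet (dBall ρ x r)
  doubling : ∃ c : ℝ≥0, ∀ (x : Ω) (r : ℝ), 0 < r →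
    m (dBall ρ x (2 * r)) ≤ c * m (dBall ρ x r)
  ball_lower : ∀ ε : ℝ, 0 < ε → ∃ c : ℝ, 0 < c ∧
    ∀ x : Ω, ENNReal.ofReal c ≤ m (dBall ρ x ε)

/-- A doubling weight: a nonnegative integrable function, not almost everywhere zero, with
`w(B(x,2r)) ≤ L w(B(x,r))`. -/
structure IsDoublingWeight {D : ℕ} {Ω : Set (Fin D → ℝ)} (ρ : MetricSpace Ω)
    (m : Measure Ω) (w : Ω → ℝ) : Prop where
  nonneg : ∀ x, 0 ≤ w x
  integrable : Integrable w m
  integral_pos : 0 < ∫ x, w x ∂m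
  doubling : ∃ L : ℝ, 0 < L ∧ ∀ (x : Ω) (r : ℝ), 0 < r →
    wMass m w (dBall ρ x (2 * r)) ≤ L * wMass m w (dBall ρ x r)

/-- Restriction of a polynomial in `D` variables to `Ω`, as a linear map. -/
def polyRestrict {D : ℕ} (Ω : Set (Fin D → ℝ)) : MvPolynomial (Fin D) ℝ →ₗ[ℝ] (Ω → ℝ) where
  toFun p := fun x => MvPolynomial.eval x.1 p
  map_add' p q := by ext x; simp
  map_smul' c p := by ext x; simp

/-- `Π_n(Ω)`: restrictions to `Ω` of polynomials of (total) degree at most `n`. -/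
def polySpace {D : ℕ} (Ω : Set (Fin D → ℝ)) (n : ℕ) : Submodule ℝ (Ω → ℝ) :=
  (MvPolynomial.restrictTotalDegree (Fin D) ℝ n).map (polyRestrict Ω)

/-- The bilinear form `⟨f,g⟩_ϖ = ∫ f g ϖ dm`. -/
def wInner {D : ℕ} {Ω : Set (Fin D → ℝ)} (m : Measure Ω) (ϖ : Ω → ℝ) (f g : Ω → ℝ) : ℝ :=
  ∫ x, f x * g x * ϖ x ∂m

/-- `⟨·,·⟩_ϖ` is a well defined inner product on every `Π_n(Ω)`. -/
def IsPolyInnerProduct {D : ℕ} {Ω : Set (Fin D → ℝ)} (m : Measure Ω) (ϖ : Ω → ℝ) : Prop :=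
  ∀ n : ℕ, ∀ f ∈ polySpace Ω n,
    Integrable (fun x => f x * f x * ϖ x) m ∧ (wInner m ϖ f f = 0 → f = 0)

/-- `V_n(Ω,ϖ)`: the orthogonal polynomials of degree `n`, i.e. the elements of `Π_n(Ω)` that are
orthogonal to all polynomials of lower degree. -/
def orthPoly {D : ℕ} {Ω : Set (Fin D → ℝ)} (m : Measure Ω) (ϖ : Ω → ℝ) (n : ℕ) :
    Set (Ω → ℝ) :=
  {f | f ∈ polySpace Ω n ∧ ∀ k < n, ∀ g ∈ polySpace Ω k, wInner m ϖ f g = 0}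

/-- The reproducing kernel `P_n(ϖ; x, ·)` of `V_n(Ω,ϖ)`: the element `p` of `V_n(Ω,ϖ)` with
`⟨f,p⟩_ϖ = f(x)` for all `f ∈ V_n(Ω,ϖ)`. It exists and is unique as soon as `⟨·,·⟩_ϖ` is an
inner product on `Π_n(Ω)`. -/
def reproKernel {D : ℕ} {Ω : Set (Fin D → ℝ)} (m : Measure Ω) (ϖ : Ω → ℝ) (n : ℕ) (x : Ω) :
    Ω → ℝ :=
  Classical.epsilon fun p : Ω → ℝ =>
    p ∈ orthPoly m ϖ n ∧ ∀ f ∈ orthPoly m ϖ n, wInner m ϖ f p = f x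

/-- Admissible cut-off functions of type (a): nonnegative and smooth on `[0,∞)`, supported in
`[0,2]`, equal to `1` on `[0,1]`. (Only the values on `[0,∞)` matter.) -/
structure IsCutoffA (a : ℝ → ℝ) : Prop where
  smooth : ContDiffOn ℝ ∞ a (Ici 0)
  nonneg : ∀ t, 0 ≤ t → 0 ≤ a t
  eq_zero : ∀ t, 2 < t → a t = 0
  eq_one : ∀ t ∈ Icc (0 : ℝ) 1, a t = 1

/-- `L_n(ϖ; x, y) = ∑_{k ≥ 0} a(k/n) P_k(ϖ; x, y)`; the terms with `k > 2n` vanish because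
`a` is supported in `[0,2]`. -/
def locKernel {D : ℕ} {Ω : Set (Fin D → ℝ)} (m : Measure Ω) (ϖ : Ω → ℝ) (a : ℝ → ℝ) (n : ℕ)
    (x y : Ω) : ℝ :=
  ∑ k ∈ Finset.range (2 * n + 1), a ((k : ℝ) / (n : ℝ)) * reproKernel m ϖ k x y

/-- Localization of the kernels. -/
def Assertion1 {D : ℕ} {Ω : Set (Fin D → ℝ)} (ρ : MetricSpace Ω) (m : Measure Ω) (ϖ : Ω → ℝ)
    (a : ℝ → ℝ) : Prop :=
  ∀ κ : ℝ, 0 < κ → ∃ c : ℝ, 0 < c ∧ ∀ n : ℕ, 1 ≤ n → ∀ x y : Ω,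
    |locKernel m ϖ a n x y| ≤
      c / (√(wMass m ϖ (dBall ρ x (1 / n))) * √(wMass m ϖ (dBall ρ y (1 / n))) *
        (1 + n * ρ.dist x y) ^ κ)

/-- Localization of the differences of the kernels. -/
def Assertion2 {D : ℕ} {Ω : Set (Fin D → ℝ)} (ρ : MetricSpace Ω) (m : Measure Ω) (ϖ : Ω → ℝ)
    (a : ℝ → ℝ) : Prop :=
  ∃ δ₀ : ℝ, 0 < δ₀ ∧ δ₀ < 1 ∧ ∀ κ : ℝ, 0 < κ → ∃ c : ℝ, 0 < c ∧
    ∀ n : ℕ, 1 ≤ n → ∀ δ : ℝ, 0 < δ → δ ≤ δ₀ →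
    ∀ x₁ x₂ y : Ω, x₁ ∈ dBall ρ x₂ (δ / n) →
    |locKernel m ϖ a n x₁ y - locKernel m ϖ a n x₂ y| ≤
      c * (n * ρ.dist x₁ x₂) /
        (√(wMass m ϖ (dBall ρ x₁ (1 / n))) * √(wMass m ϖ (dBall ρ x₂ (1 / n))) *
          (1 + n * ρ.dist x₂ y) ^ κ)

/-- The integral bound, for all sufficiently large `κ`. -/
def Assertion3 {D : ℕ} {Ω : Set (Fin D → ℝ)} (ρ : MetricSpace Ω) (m : Measure Ω)
    (ϖ : Ω → ℝ) : Prop :=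
  ∃ κ₀ : ℝ, 0 < κ₀ ∧ ∀ κ : ℝ, κ₀ ≤ κ → ∃ c : ℝ, 0 < c ∧ ∀ n : ℕ, 1 ≤ n → ∀ x : Ω,
    Integrable (fun y =>
      ϖ y / (wMass m ϖ (dBall ρ y (1 / n)) * (1 + n * ρ.dist x y) ^ κ)) m ∧
    ∫ y, ϖ y / (wMass m ϖ (dBall ρ y (1 / n)) * (1 + n * ρ.dist x y) ^ κ) ∂m ≤ c

/-- `(Ω, ϖ, d)` is a localizable homogeneous space, with kernels `L_n(ϖ; ·, ·)` formed with the
cut-off function `a`: `ϖ` is a normalized doubling weight for which orthogonal polynomials make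
sense, and the kernels are highly localized. -/
structure IsLocalizable {D : ℕ} {Ω : Set (Fin D → ℝ)} (ρ : MetricSpace Ω) (m : Measure Ω)
    (ϖ : Ω → ℝ) (a : ℝ → ℝ) : Prop where
  doublingWeight : IsDoublingWeight ρ m ϖ
  normalized : ∫ x, ϖ x ∂m = 1
  innerProduct : IsPolyInnerProduct m ϖ
  assertion1 : Assertion1 ρ m ϖ a
  assertion2 : Assertion2 ρ m ϖ a
  assertion3 : Assertion3 ρ m ϖ

/-- `Ω` is compact and carries fast decaying polynomials: `T x y` is `T_x(y)`. The polynomials and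
the constants may depend on the decay exponent `γ`; the constants do not depend on `n` and `x`. -/
def Assertion4 {D : ℕ} {Ω : Set (Fin D → ℝ)} (ρ : MetricSpace Ω) : Prop :=
  IsCompact Ω ∧ ∀ γ : ℝ, 1 < γ →
    ∃ δ : ℝ, 0 < δ ∧ ∃ c : ℝ, 0 < c ∧ ∃ c₁ : ℝ, 0 < c₁ ∧ ∃ c₂ : ℝ, 0 < c₂ ∧
    ∃ r : ℕ, 0 < r ∧ ∀ n : ℕ, 1 ≤ n →
    ∃ T : Ω → Ω → ℝ,
      (∀ x, T x ∈ polySpace Ω n ∧ T x x = 1 ∧ (∀ y ∈ dBall ρ x (1 / n), δ ≤ T x y) ∧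
        ∀ y, 0 ≤ T x y ∧ T x y ≤ c * (1 + n * ρ.dist x y) ^ (-γ)) ∧
      ∃ q : Ω → ℝ, (∃ N : ℕ, q ∈ polySpace Ω N) ∧ (∀ x, c₁ ≤ q x ∧ q x ≤ c₂) ∧
        ∀ y, (fun x => q x * T x y) ∈ polySpace Ω (r * n)

/-- `Ξ` is a maximal `ε`-separated subset of `Ω`: distinct points have distance at least `ε`, and
`1 ≤ ∑_{z ∈ Ξ} χ_{B(z,ε)}(x) ≤ c_d` for all `x`, with some constant `c_d > 1`. -/
structure IsMaximalSeparated {D : ℕ} {Ω : Set (Fin D → ℝ)} (ρ : MetricSpace Ω) (ε : ℝ)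
    (Ξ : Set Ω) : Prop where
  separated : ∀ x ∈ Ξ, ∀ y ∈ Ξ, x ≠ y → ε ≤ ρ.dist x y
  maximal : ∃ c : ℕ, 1 < c ∧ ∀ x : Ω,
    1 ≤ {z ∈ Ξ | x ∈ dBall ρ z ε}.encard ∧ {z ∈ Ξ | x ∈ dBall ρ z ε}.encard ≤ c

end

end LocHom

/-! Write `μ` for ϖ dm and `ν` for w dm. Since `L_n` reproduces `Π_n`, subtracting the reproducing
formulas at two nearby points and inserting the localized kernel differences bounds the oscillation
of a polynomial at scale `δ/n` by `δ` times a local mean of `|f|`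
(`IsLocalizable.exists_hasLocalOscillation`).

This mean is taken against `μ`, while the quadrature concerns `ν`. The passage uses an auxiliary
cell partition at a fixed small scale `δ₁/n`, independent of `δ`, and the sum `transferSum` of the
`μ`-integrals of `|f|` over its cells with weights `ν(B)/μ(B)`. Doubling beats the polynomial decay
on dyadic shells, so sums of local means are at most a constant times this sum. Conversely, small
oscillation on each cell bounds the sum by the `L¹(ν)` norm plus half of itself, and the half is
absorbed (`transferSum_le`). The result is a Marcinkiewicz–Zygmund inequality with error `K δ ‖f‖`
in `L¹(ν)` (`exists_sum_integral_abs_sub_le`).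

For small `δ`, the Riemann sum over cells `E_z` around the nodes therefore differs from the integral
by at most half of `∑ ν(E_z)|f(z)|`. Hahn–Banach (`exists_coeff_of_abs_le`) writes the error as `∑
b_z f(z)` with `|b_z| ≤ ν(E_z)/2`. Then `λ_z = ν(E_z) + b_z` is exact, positive and comparable to
`ν(E_z)`, hence by doubling to the mass of the ball. -/

namespace LocHom

/-- A measure on a metric space is doubling with constant `L`. -/
def IsDoublingMeasure {X : Type*} [PseudoMetricSpace X] [MeasurableSpace X] (μ : Measure X)
    (L : ℝ) : Prop :=
  ∀ (x : X) (r : ℝ), 0 < r → μ.real (Metric.ball x (2 * r)) ≤ L * μ.real (Metric.ball x r)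

/-- `C` partitions the space into measurable cells, the cell of `z ∈ Z` lying between the balls
of radii `ε / 2` and `ε` about `z`. -/
structure IsCellPartition {X : Type*} [PseudoMetricSpace X] [MeasurableSpace X]
    (Z : Finset X) (ε : ℝ) (C : X → Set X) : Prop where
  measurableSet : ∀ z ∈ Z, MeasurableSet (C z)
  disjoint : (Z : Set X).PairwiseDisjoint C
  iUnion_eq : ⋃ z ∈ Z, C z = univ
  ball_subset : ∀ z ∈ Z, Metric.ball z (ε / 2) ⊆ C z
  subset_ball : ∀ z ∈ Z, C z ⊆ Metric.ball z ε

/-! ### Doubling measures, separated sets, cell partitions and dyadic summation. -/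

section Geometry

variable {X : Type*} [PseudoMetricSpace X] [MeasurableSpace X]

theorem IsDoublingMeasure.mono {μ : Measure X} {L L' : ℝ} (h : IsDoublingMeasure μ L)
    (hL : L ≤ L') : IsDoublingMeasure μ L' := fun x r hr =>
  (h x r hr).trans (mul_le_mul_of_nonneg_right hL measureReal_nonneg)

theorem IsDoublingMeasure.real_ball_pow_le {μ : Measure X} {L : ℝ} (h : IsDoublingMeasure μ L)
    (hL : 0 ≤ L) (x : X) {r : ℝ} (hr : 0 < r) (k : ℕ) :
    μ.real (Metric.ball x (2 ^ k * r)) ≤ L ^ k * μ.real (Metric.ball x r) := by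
  induction k with
  | zero => simp
  | succ k ih =>
    calc μ.real (Metric.ball x (2 ^ (k + 1) * r))
        = μ.real (Metric.ball x (2 * (2 ^ k * r))) := by rw [pow_succ]; ring_nf
      _ ≤ L * μ.real (Metric.ball x (2 ^ k * r)) := h x _ (by positivity)
      _ ≤ L * (L ^ k * μ.real (Metric.ball x r)) := by gcongr
      _ = _ := by ring

theorem iUnion_ball_two_pow {X : Type*} [PseudoMetricSpace X] (x : X) {r : ℝ} (hr : 0 < r) :
    ⋃ k : ℕ, Metric.ball x (2 ^ k * r) = univ := by
  refine eq_univ_of_forall fun y => mem_iUnion.2 ?_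
  obtain ⟨k, hk⟩ := pow_unbounded_of_one_lt (dist y x / r) (one_lt_two (α := ℝ))
  exact ⟨k, by rw [Metric.mem_ball]; exact (div_lt_iff₀ hr).1 hk⟩

/-- If one ball were null, so would be all its dyadic dilates, and these exhaust the space. -/
theorem IsDoublingMeasure.real_ball_pos {μ : Measure X} [IsFiniteMeasure μ] {L : ℝ}
    (h : IsDoublingMeasure μ L) (hL : 0 ≤ L) (hμ : μ ≠ 0) (x : X) {r : ℝ} (hr : 0 < r) :
    0 < μ.real (Metric.ball x r) := by
  refine lt_of_le_of_ne measureReal_nonneg fun h0 => hμ ?_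
  rw [← Measure.measure_univ_eq_zero, ← iUnion_ball_two_pow x hr]
  refine measure_iUnion_null fun k => ?_
  have := h.real_ball_pow_le hL x hr k
  rw [← h0, mul_zero] at this
  exact (measureReal_eq_zero_iff).1 (le_antisymm this measureReal_nonneg)

/-- A space carrying a nonzero finite doubling measure is bounded. -/
theorem IsDoublingMeasure.exists_dist_lt {μ : Measure X} [IsFiniteMeasure μ] {L : ℝ}
    (h : IsDoublingMeasure μ L) (hL : 0 ≤ L) (hμ : μ ≠ 0)
    (hball : ∀ (x : X) (r : ℝ), MeasurableSet (Metric.ball x r)) :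
    ∃ R : ℝ, 0 < R ∧ ∀ x y : X, dist x y < R := by
  have hM : 0 < μ.real univ := by
    rw [measureReal_def]
    exact ENNReal.toReal_pos (by simpa using hμ) (measure_ne_top _ _)
  obtain ⟨x₀⟩ : Nonempty X := by
    by_contra hX
    rw [not_nonempty_iff] at hX
    exact hμ (Measure.eq_zero_of_isEmpty μ)
  set M := μ.real univ
  -- A ball about a far point `x`, of radius half its distance to `x₀`, is disjoint from the central
  -- ball and has at least `L⁻²` of its mass. This fraction of the total mass leaves no room for
  -- both.
  obtain ⟨k, hk⟩ : ∃ k : ℕ, M * (L ^ 2 / (L ^ 2 + 1)) < μ.real (Metric.ball x₀ (2 ^ k * 1)) := by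
    have hmono : Monotone fun k : ℕ => Metric.ball x₀ ((2 : ℝ) ^ k * 1) := fun i j hij =>
      Metric.ball_subset_ball (by gcongr; norm_num)
    have ht := tendsto_measure_iUnion_atTop (μ := μ) hmono
    rw [iUnion_ball_two_pow x₀ one_pos] at ht
    have ht' := (ENNReal.tendsto_toReal (measure_ne_top μ univ)).comp ht
    refine (ht'.eventually_const_lt (u := M * (L ^ 2 / (L ^ 2 + 1))) ?_).exists
    change _ < M
    have : L ^ 2 / (L ^ 2 + 1) < 1 := by rw [div_lt_one (by positivity)]; linarith
    nlinarith
  set R : ℝ := 2 ^ k * 1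
  have hR : 0 < R := by positivity
  have key : ∀ x, dist x x₀ < 2 * R := by
    intro x
    by_contra! hx
    set s := dist x x₀
    have h1 : μ.real (Metric.ball x₀ R) ≤ L ^ 2 * μ.real (Metric.ball x (s / 2)) := by
      refine le_trans (measureReal_mono ?_) (h.real_ball_pow_le hL x (by linarith) 2)
      intro y hy
      rw [Metric.mem_ball] at hy ⊢
      have := dist_triangle y x₀ x
      rw [dist_comm x₀ x] at this
      linarith
    have h2 : μ.real (Metric.ball x (s / 2)) + μ.real (Metric.ball x₀ R) ≤ M := by
      rw [← measureReal_union (Metric.ball_disjoint_ball (by linarith)) (hball _ _)]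
      exact measureReal_mono (subset_univ _)
    have h3 : M * L ^ 2 < μ.real (Metric.ball x₀ R) * (L ^ 2 + 1) := by
      rwa [← mul_div_assoc, div_lt_iff₀ (by positivity)] at hk
    nlinarith [sq_nonneg L]
  refine ⟨4 * R, by linarith, fun x y => ?_⟩
  have := dist_triangle_right x y x₀
  linarith [key x, key y]

/-- The space is bounded, so a fixed number of doublings turns every ball of radius `r` into the
whole space. -/
theorem IsDoublingMeasure.exists_le_real_ball {μ : Measure X} [IsFiniteMeasure μ] {L : ℝ}
    (h : IsDoublingMeasure μ L) (hL : 0 < L) (hμ : μ ≠ 0)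
    (hball : ∀ (x : X) (r : ℝ), MeasurableSet (Metric.ball x r)) {r : ℝ} (hr : 0 < r) :
    ∃ c : ℝ, 0 < c ∧ ∀ x : X, c ≤ μ.real (Metric.ball x r) := by
  obtain ⟨R, hR, hd⟩ := h.exists_dist_lt hL.le hμ hball
  obtain ⟨k, hk⟩ := pow_unbounded_of_one_lt (R / r) (one_lt_two (α := ℝ))
  rw [div_lt_iff₀ hr] at hk
  have hM : 0 < μ.real univ := by
    rw [measureReal_def]
    exact ENNReal.toReal_pos (by simpa using hμ) (measure_ne_top _ _)
  refine ⟨μ.real univ / L ^ k, by positivity, fun x => ?_⟩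
  rw [div_le_iff₀' (by positivity)]
  refine le_trans (measureReal_mono fun y _ => ?_) (h.real_ball_pow_le hL.le x hr k)
  exact (hd y x).trans hk

/-- The half-radius balls are disjoint and their masses are uniformly bounded below, while the total
mass is finite. -/
theorem IsDoublingMeasure.finite_of_separated {μ : Measure X} [IsFiniteMeasure μ] {L : ℝ}
    (h : IsDoublingMeasure μ L) (hL : 0 < L) (hμ : μ ≠ 0)
    (hball : ∀ (x : X) (r : ℝ), MeasurableSet (Metric.ball x r)) {ε : ℝ} (hε : 0 < ε)
    {Ξ : Set X} (hΞ : Ξ.Pairwise fun x y => ε ≤ dist x y) : Ξ.Finite := by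
  obtain ⟨c, hc, hcb⟩ := h.exists_le_real_ball hL hμ hball (half_pos hε)
  have := Measure.finite_const_le_meas_of_disjoint_iUnion μ (ε := ENNReal.ofReal c)
    (ENNReal.ofReal_pos.2 hc) (As := fun z : Ξ => Metric.ball (z : X) (ε / 2))
    (fun z => hball _ _) (fun x y hxy => Metric.ball_disjoint_ball
      (by linarith [hΞ x.2 y.2 (Subtype.coe_injective.ne hxy)])) (measure_ne_top _ _)
  have hu : {i : Ξ | ENNReal.ofReal c ≤ μ (Metric.ball (i : X) (ε / 2))} = univ :=
    eq_univ_of_forall fun z => ENNReal.ofReal_le_of_le_toReal (hcb z)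
  rw [hu] at this
  exact Set.finite_coe_iff.1 (Set.finite_univ_iff.1 this)

/-- Supplies the auxiliary net at the fixed scale `δ₁/t`, chosen independently of the quadrature
nodes. -/
theorem exists_maximal_separated {X : Type*} [PseudoMetricSpace X] {ε : ℝ} (hε : 0 < ε) :
    ∃ Z : Set X, (Z.Pairwise fun x y => ε ≤ dist x y) ∧ ∀ x, ∃ z ∈ Z, dist x z < ε := by
  obtain ⟨Z, hZ⟩ := zorn_subset {Z : Set X | Z.Pairwise fun x y => ε ≤ dist x y} (by
    intro c hc hch
    exact ⟨⋃₀ c, (pairwise_sUnion hch.directedOn).2 fun s hs => hc hs,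
      fun s hs => subset_sUnion_of_mem hs⟩)
  refine ⟨Z, hZ.prop, fun x => ?_⟩
  by_contra! hx
  have hins : (insert x Z).Pairwise fun x y => ε ≤ dist x y :=
    hZ.prop.insert fun b hb _ => ⟨hx b hb, by rw [dist_comm]; exact hx b hb⟩
  have := hx x (hZ.le_of_ge hins (subset_insert _ _) (mem_insert _ _))
  rw [dist_self] at this
  linarith

/-- From each `ε`-ball the half-balls of the other centres are removed first. The overlaps that
remain are resolved by an enumeration of the centres, which cannot remove any point of a half-ball.
-/
theorem exists_isCellPartition (hball : ∀ (x : X) (r : ℝ), MeasurableSet (Metric.ball x r))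
    {ε : ℝ} (hε : 0 < ε) {Z : Finset X} (hsep : (Z : Set X).Pairwise fun x y => ε ≤ dist x y)
    (hcov : ∀ x, ∃ z ∈ Z, dist x z < ε) : ∃ C : X → Set X, IsCellPartition Z ε C := by
  obtain ⟨e, he⟩ := Set.countable_iff_exists_injOn.1 Z.countable_toSet
  set A : X → Set X := fun z =>
    Metric.ball z ε \ ⋃ z' ∈ Z, ⋃ _ : z' ≠ z, Metric.ball z' (ε / 2) with hA
  have hAm : ∀ z, MeasurableSet (A z) := fun z =>
    (hball _ _).diff (Finset.measurableSet_biUnion _ fun _ _ =>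
      MeasurableSet.iUnion fun _ => hball _ _)
  have hsub : ∀ z ∈ Z, Metric.ball z (ε / 2) ⊆ A z := by
    intro z hz y hy
    refine ⟨Metric.ball_subset_ball (by linarith) hy, ?_⟩
    simp only [mem_iUnion, not_exists]
    intro z' hz' hne hy'
    exact (Metric.ball_disjoint_ball (by linarith [hsep hz' hz hne])).le_bot ⟨hy', hy⟩
  have hdisj : ∀ z' ∈ Z, ∀ z, z' ≠ z → ∀ y ∈ Metric.ball z' (ε / 2), y ∉ A z := by
    intro z' hz' z hne y hy hyA
    exact hyA.2 (mem_iUnion₂.2 ⟨z', hz', mem_iUnion.2 ⟨hne, hy⟩⟩)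
  have hAcov : ∀ y, ∃ z ∈ Z, y ∈ A z := by
    intro y
    by_cases hy : ∃ z ∈ Z, y ∈ Metric.ball z (ε / 2)
    · obtain ⟨z, hz, hyz⟩ := hy
      exact ⟨z, hz, hsub z hz hyz⟩
    · push Not at hy
      obtain ⟨z, hz, hyz⟩ := hcov y
      refine ⟨z, hz, hyz, ?_⟩
      simp only [mem_iUnion, not_exists]
      exact fun z' hz' _ => hy z' hz'
  refine ⟨fun z => A z \ ⋃ z' ∈ Z, ⋃ _ : e z' < e z, A z', ?_, ?_, ?_, ?_, ?_⟩
  · exact fun z _ => (hAm z).diff (Finset.measurableSet_biUnion _ fun _ _ =>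
      MeasurableSet.iUnion fun _ => hAm _)
  · intro z hz z' hz' hne
    refine Set.disjoint_left.2 fun y hy hy' => ?_
    rcases lt_or_gt_of_ne (he.ne hz hz' hne) with hlt | hlt
    · exact hy'.2 (mem_iUnion₂.2 ⟨z, hz, mem_iUnion.2 ⟨hlt, hy.1⟩⟩)
    · exact hy.2 (mem_iUnion₂.2 ⟨z', hz', mem_iUnion.2 ⟨hlt, hy'.1⟩⟩)
  · refine eq_univ_of_forall fun y => ?_
    classical
    obtain ⟨z, hz, hmin⟩ := (Z.filter fun z => y ∈ A z).exists_min_image e (by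
      obtain ⟨z, hz, hy⟩ := hAcov y
      exact ⟨z, Finset.mem_filter.2 ⟨hz, hy⟩⟩)
    rw [Finset.mem_filter] at hz
    refine mem_iUnion₂.2 ⟨z, hz.1, hz.2, ?_⟩
    simp only [mem_iUnion, not_exists]
    intro z' hz' hlt hy
    exact (hmin z' (Finset.mem_filter.2 ⟨hz', hy⟩)).not_gt hlt
  · intro z hz y hy
    refine ⟨hsub z hz hy, ?_⟩
    simp only [mem_iUnion, not_exists]
    intro z' _ hlt
    exact hdisj z hz z' (fun h => by simp [h] at hlt) y hy
  · exact fun z _ y hy => hy.1.1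

theorem IsCellPartition.integral_eq_sum {Z : Finset X} {ε : ℝ} {C : X → Set X}
    (hC : IsCellPartition Z ε C) {μ : Measure X} {f : X → ℝ} (hf : Integrable f μ) :
    ∫ y, f y ∂μ = ∑ z ∈ Z, ∫ y in C z, f y ∂μ := by
  rw [← integral_biUnion_finset Z hC.measurableSet hC.disjoint fun _ _ => hf.integrableOn,
    hC.iUnion_eq, Measure.restrict_univ]

theorem IsCellPartition.sum_real_le {Z s : Finset X} {ε : ℝ} {C : X → Set X}
    (hC : IsCellPartition Z ε C) (μ : Measure X) [IsFiniteMeasure μ] (hs : s ⊆ Z) {S : Set X}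
    (hS : ∀ z ∈ s, C z ⊆ S) : ∑ z ∈ s, μ.real (C z) ≤ μ.real S := by
  rw [← measureReal_biUnion_finset (hC.disjoint.subset (by simpa using hs))
    fun z hz => hC.measurableSet z (hs hz)]
  exact measureReal_mono (iUnion₂_subset hS)

/-- Summation over dyadic shells. -/
theorem sum_div_pow_le_of_dyadic {ι : Type*} (s : Finset ι) (a v : ι → ℝ) (ha : ∀ i ∈ s, 1 ≤ a i)
    (hv : ∀ i ∈ s, 0 ≤ v i) {V H : ℝ} (hV : 0 ≤ V) (hH : 0 ≤ H) {κ : ℕ} (hκ : 2 * H ≤ 2 ^ κ)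
    (hsum : ∀ j : ℕ, ∑ i ∈ s with a i < 2 ^ (j + 1), v i ≤ V * H ^ j) :
    ∑ i ∈ s, v i / a i ^ κ ≤ 2 * V := by
  classical
  have hex : ∀ i, ∃ j : ℕ, i ∈ s → 2 ^ j ≤ a i ∧ a i < 2 ^ (j + 1) := by
    intro i
    by_cases hi : i ∈ s
    · obtain ⟨j, hj⟩ := exists_nat_pow_near (ha i hi) (one_lt_two (α := ℝ))
      exact ⟨j, fun _ => hj⟩
    · exact ⟨0, fun h => absurd h hi⟩
  choose j hj using hex
  -- Group by shells `2^k ≤ a i < 2^(k+1)`. Growth `H^k` against decay `2^(-κk)` leaves a geometric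
  -- series of ratio `1/2`.
  rw [← Finset.sum_fiberwise_of_maps_to (s := s) (t := s.image j)
    fun i hi => Finset.mem_image_of_mem j hi]
  have hbound : ∀ k ∈ s.image j, ∑ i ∈ s with j i = k, v i / a i ^ κ ≤ V * (1 / 2) ^ k := by
    intro k _
    calc ∑ i ∈ s with j i = k, v i / a i ^ κ
        ≤ ∑ i ∈ s with j i = k, v i / (2 ^ k) ^ κ := by
          refine Finset.sum_le_sum fun i hi => ?_
          obtain ⟨his, hik⟩ := Finset.mem_filter.1 hi
          have h1 := (hj i his).1
          rw [hik] at h1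
          exact div_le_div_of_nonneg_left (hv i his) (by positivity)
            (pow_le_pow_left₀ (by positivity) h1 κ)
      _ = (∑ i ∈ s with j i = k, v i) / (2 ^ κ) ^ k := by
          rw [Finset.sum_div, ← pow_mul, ← pow_mul, mul_comm]
      _ ≤ (V * H ^ k) / (2 ^ κ) ^ k := by
          gcongr
          refine le_trans (Finset.sum_le_sum_of_subset_of_nonneg ?_ ?_) (hsum k)
          · intro i hi
            obtain ⟨his, hik⟩ := Finset.mem_filter.1 hi
            exact Finset.mem_filter.2 ⟨his, hik ▸ (hj i his).2⟩
          · exact fun i hi _ => hv i (Finset.mem_filter.1 hi).1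
      _ ≤ V * (1 / 2) ^ k := by
          rw [mul_div_assoc, ← div_pow]
          refine mul_le_mul_of_nonneg_left (pow_le_pow_left₀ (by positivity) ?_ k) hV
          rw [div_le_div_iff₀ (by positivity) (by positivity)]
          linarith
  calc _ ≤ ∑ k ∈ s.image j, V * (1 / 2 : ℝ) ^ k := Finset.sum_le_sum hbound
    _ = V * ∑ k ∈ s.image j, (1 / 2 : ℝ) ^ k := by rw [Finset.mul_sum]
    _ ≤ V * 2 := by
        gcongr
        exact (summable_geometric_two.sum_le_tsum _ fun _ _ => by positivity).trans
          tsum_geometric_two.le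
    _ = 2 * V := by ring

end Geometry

/-- A linear functional dominated by a weighted `ℓ¹` norm of point values is given by a
quadrature sum whose coefficients are bounded by the weights. -/
theorem exists_coeff_of_abs_le {X : Type*} (V : Submodule ℝ (X → ℝ)) (Φ : V →ₗ[ℝ] ℝ)
    (Z : Finset X) (v : X → ℝ) (hv : ∀ z ∈ Z, 0 ≤ v z)
    (hΦ : ∀ f : V, |Φ f| ≤ ∑ z ∈ Z, v z * |f.1 z|) :
    ∃ b : X → ℝ, (∀ z ∈ Z, |b z| ≤ v z) ∧ ∀ f : V, Φ f = ∑ z ∈ Z, b z * f.1 z := by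
  classical
  -- Hahn–Banach extends `Φ` to all functions, so that it can be evaluated on point indicators.
  obtain ⟨g, hgext, hg⟩ := exists_extension_of_le_sublinear ⟨V, Φ⟩
    (fun f : X → ℝ => ∑ z ∈ Z, v z * |f z|)
    (fun c hc x => by
      simp only [Pi.smul_apply, smul_eq_mul, abs_mul, abs_of_pos hc, Finset.mul_sum]
      exact Finset.sum_congr rfl fun _ _ => by ring)
    (fun x y => by
      rw [← Finset.sum_add_distrib]
      refine Finset.sum_le_sum fun z hz => ?_
      rw [← mul_add]
      exact mul_le_mul_of_nonneg_left (abs_add_le _ _) (hv z hz))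
    (fun f => (le_abs_self _).trans (hΦ f))
  have habs : ∀ f : X → ℝ, |g f| ≤ ∑ z ∈ Z, v z * |f z| := by
    intro f
    refine abs_le.2 ⟨?_, hg f⟩
    have := hg (-f)
    simp only [map_neg, Pi.neg_apply, abs_neg] at this
    linarith
  refine ⟨fun z => g (Pi.single z 1), fun z hz => ?_, fun f => ?_⟩
  · refine (habs _).trans (le_of_eq ?_)
    rw [Finset.sum_eq_single z]
    · simp
    · intro z' _ hne
      simp [hne]
    · exact fun h => absurd hz h
  -- The dominating seminorm sees only values on `Z`, so `g` annihilates the difference between `f`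
  -- and its restriction to `Z`.
  · have h0 := habs (f.1 - ∑ z ∈ Z, f.1 z • Pi.single z (1 : ℝ))
    have hz : ∑ z ∈ Z, v z * |(f.1 - ∑ z ∈ Z, f.1 z • Pi.single z (1 : ℝ)) z| = 0 := by
      refine Finset.sum_eq_zero fun z hz => ?_
      simp [Finset.sum_apply, Pi.single_apply, hz]
    rw [hz] at h0
    have h1 := abs_nonpos_iff.1 h0
    rw [map_sub, sub_eq_zero] at h1
    have h2 : g f.1 = Φ f := hgext f
    rw [← h2, h1, map_sum]
    exact Finset.sum_congr rfl fun z _ => by rw [map_smul, smul_eq_mul, mul_comm]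

end LocHom

namespace LocHom

/-! ### Local means, change of measure, and quadrature on a doubling space. -/

section Core

variable {X : Type*} [PseudoMetricSpace X] [MeasurableSpace X]

/-- The average of `|f|` against `μ`, localized around `x` at scale `1 / t` with polynomial
decay of order `κ`. -/
noncomputable def localMean (μ : Measure X) (κ : ℕ) (t : ℝ) (f : X → ℝ) (x : X) : ℝ :=
  (∫ y, |f y| / (1 + t * dist x y) ^ κ ∂μ) / μ.real (Metric.ball x (1 / t))

/-- The σ-algebra is not assumed to be the Borel one of this metric; measurability of the balls
suffices. -/
theorem measurable_dist_of_ball (hball : ∀ (x : X) (r : ℝ), MeasurableSet (Metric.ball x r))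
    (x : X) : Measurable fun y => dist x y := by
  refine measurable_of_Iio fun r => ?_
  have : (fun y => dist x y) ⁻¹' Iio r = Metric.ball x r := by
    ext y
    simp [Metric.mem_ball, dist_comm]
  rw [this]
  exact hball x r

theorem integrable_abs_div_pow (hball : ∀ (x : X) (r : ℝ), MeasurableSet (Metric.ball x r))
    {μ : Measure X} {f : X → ℝ} (hf : Integrable f μ) {t : ℝ} (ht : 0 < t) (κ : ℕ) (x : X) :
    Integrable (fun y => |f y| / (1 + t * dist x y) ^ κ) μ := by
  have hm : Measurable fun y => ((1 + t * dist x y) ^ κ)⁻¹ :=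
    (((measurable_dist_of_ball hball x).const_mul t).const_add 1).pow_const κ |>.inv
  simp only [div_eq_mul_inv]
  refine hf.abs.mul_bdd (c := 1) hm.aestronglyMeasurable (ae_of_all _ fun y => ?_)
  have h1 : (1 : ℝ) ≤ 1 + t * dist x y := by
    have := mul_nonneg ht.le (dist_nonneg (x := x) (y := y))
    linarith
  rw [Real.norm_of_nonneg (by positivity)]
  exact inv_le_one_of_one_le₀ (one_le_pow₀ h1)

theorem localMean_nonneg (μ : Measure X) (κ : ℕ) {t : ℝ} (ht : 0 < t) (f : X → ℝ) (x : X) :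
    0 ≤ localMean μ κ t f x :=
  div_nonneg (integral_nonneg fun y => by positivity) measureReal_nonneg

/-- Cells have radius at most `1/t`, so the decay factor varies on a cell by a factor of at most `2
^ κ`. -/
theorem localMean_le_sum (hball : ∀ (x : X) (r : ℝ), MeasurableSet (Metric.ball x r))
    {μ : Measure X} {f : X → ℝ} (hf : Integrable f μ) {t : ℝ} (ht : 0 < t) (κ : ℕ)
    {Z : Finset X} {ε : ℝ} {C : X → Set X} (hC : IsCellPartition Z ε C) (hε : ε ≤ 1 / t) (x : X) :
    localMean μ κ t f x ≤
      (∑ z ∈ Z, 2 ^ κ * (∫ y in C z, |f y| ∂μ) / (1 + t * dist x z) ^ κ) /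
        μ.real (Metric.ball x (1 / t)) := by
  refine div_le_div_of_nonneg_right ?_ measureReal_nonneg
  have hi := integrable_abs_div_pow hball hf ht κ x
  rw [hC.integral_eq_sum hi]
  refine Finset.sum_le_sum fun z hz => ?_
  rw [mul_div_right_comm, ← integral_const_mul]
  refine setIntegral_mono_on hi.integrableOn (hf.abs.integrableOn.const_mul _)
    (hC.measurableSet z hz) fun y hy => ?_
  rw [div_eq_mul_inv, mul_comm, ← div_pow]
  refine mul_le_mul_of_nonneg_right ?_ (abs_nonneg _)
  rw [← inv_pow]
  refine pow_le_pow_left₀ (by positivity) ?_ κ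
  rw [inv_eq_one_div, div_le_div_iff₀ (by positivity) (by positivity)]
  have h1 : t * dist y z < 1 := by
    have := (Metric.mem_ball.1 (hC.subset_ball z hz hy)).trans_le hε
    rwa [lt_div_iff₀ ht, mul_comm] at this
  have h2 : t * dist x z ≤ t * dist x y + t * dist y z := by
    rw [← mul_add]
    exact mul_le_mul_of_nonneg_left (dist_triangle _ _ _) ht.le
  have h3 : 0 ≤ t * dist x y := by positivity
  linarith

/-- Discretize the means over the cells, exchange the two sums and add over shells around each `z`.
The weights `v` and `V` are kept general because two different sums of means are needed. -/
theorem sum_mul_localMean_le (hball : ∀ (x : X) (r : ℝ), MeasurableSet (Metric.ball x r))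
    {μ : Measure X} {f : X → ℝ} (hf : Integrable f μ) {t : ℝ} (ht : 0 < t) {κ : ℕ}
    {Z : Finset X} {ε : ℝ} {C : X → Set X} (hC : IsCellPartition Z ε C) (hε : ε ≤ 1 / t)
    (Ξ : Finset X) (v V : X → ℝ) (hv : ∀ x ∈ Ξ, 0 ≤ v x) (hV : ∀ z ∈ Z, 0 ≤ V z) {H : ℝ}
    (hH : 0 ≤ H) (hκ : 2 * H ≤ 2 ^ κ)
    (hsum : ∀ z ∈ Z, ∀ j : ℕ, ∑ x ∈ Ξ with 1 + t * dist x z < 2 ^ (j + 1),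
      v x / μ.real (Metric.ball x (1 / t)) ≤ V z * H ^ j) :
    ∑ x ∈ Ξ, v x * localMean μ κ t f x ≤
      2 ^ (κ + 1) * ∑ z ∈ Z, V z * ∫ y in C z, |f y| ∂μ := by
  calc ∑ x ∈ Ξ, v x * localMean μ κ t f x
      ≤ ∑ x ∈ Ξ, v x * ((∑ z ∈ Z, 2 ^ κ * (∫ y in C z, |f y| ∂μ) / (1 + t * dist x z) ^ κ) /
        μ.real (Metric.ball x (1 / t))) := Finset.sum_le_sum fun x hx =>
          mul_le_mul_of_nonneg_left (localMean_le_sum hball hf ht κ hC hε x) (hv x hx)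
    _ = ∑ z ∈ Z, (2 ^ κ * ∫ y in C z, |f y| ∂μ) *
        ∑ x ∈ Ξ, v x / μ.real (Metric.ball x (1 / t)) / (1 + t * dist x z) ^ κ := by
        simp only [Finset.sum_div, Finset.mul_sum]
        rw [Finset.sum_comm]
        exact Finset.sum_congr rfl fun z _ => Finset.sum_congr rfl fun x _ => by ring
    _ ≤ ∑ z ∈ Z, (2 ^ κ * ∫ y in C z, |f y| ∂μ) * (2 * V z) := by
        refine Finset.sum_le_sum fun z hz => mul_le_mul_of_nonneg_left ?_
          (mul_nonneg (by positivity) (integral_nonneg fun _ => abs_nonneg _))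
        refine sum_div_pow_le_of_dyadic Ξ (fun x => 1 + t * dist x z) _ (fun x _ => ?_)
          (fun x hx => div_nonneg (hv x hx) measureReal_nonneg) (hV z hz) hH hκ (hsum z hz)
        have : 0 ≤ t * dist x z := by positivity
        linarith
    _ = _ := by
        rw [Finset.mul_sum]
        exact Finset.sum_congr rfl fun z _ => by ring

/-- The summand `1` in the shell condition absorbs the radius: the ball about `x` lies in the ball
of radius `2^(j+1)/t` about `z`. -/
theorem IsDoublingMeasure.real_ball_le_of_shell {μ : Measure X} [IsFiniteMeasure μ] {L : ℝ}
    (h : IsDoublingMeasure μ L) (hL : 0 ≤ L) {t : ℝ} (ht : 0 < t) {x z : X} {j : ℕ}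
    (hj : 1 + t * dist x z < 2 ^ (j + 1)) :
    μ.real (Metric.ball x (1 / t)) ≤ L ^ (j + 1) * μ.real (Metric.ball z (1 / t)) := by
  refine le_trans (measureReal_mono fun y hy => ?_)
    (h.real_ball_pow_le hL z (one_div_pos.2 ht) (j + 1))
  rw [Metric.mem_ball, lt_div_iff₀ ht] at hy
  rw [Metric.mem_ball, ← mul_div_assoc, lt_div_iff₀ ht]
  have := mul_le_mul_of_nonneg_right (dist_triangle y x z) ht.le
  linarith

theorem IsCellPartition.sum_real_shell_le {μ : Measure X} [IsFiniteMeasure μ] {L : ℝ}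
    (h : IsDoublingMeasure μ L) (hL : 0 ≤ L) {t : ℝ} (ht : 0 < t) {Z : Finset X} {ε : ℝ}
    {C : X → Set X} (hC : IsCellPartition Z ε C) (hε : ε ≤ 1 / t) (z : X) (j : ℕ) :
    ∑ x ∈ Z with 1 + t * dist x z < 2 ^ (j + 1), μ.real (C x) ≤
      L ^ (j + 1) * μ.real (Metric.ball z (1 / t)) := by
  refine le_trans (hC.sum_real_le μ (Finset.filter_subset _ _) fun x hx y hy => ?_)
    (h.real_ball_pow_le hL z (one_div_pos.2 ht) (j + 1))
  obtain ⟨hxZ, hxj⟩ := Finset.mem_filter.1 hx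
  have hy' := (Metric.mem_ball.1 (hC.subset_ball x hxZ hy)).trans_le hε
  rw [lt_div_iff₀ ht] at hy'
  rw [Metric.mem_ball, ← mul_div_assoc, lt_div_iff₀ ht]
  have := mul_le_mul_of_nonneg_right (dist_triangle y x z) ht.le
  linarith

/-- The weighted sum `∑ (ν(B_z) / μ(B_z)) ∫_{C_z} |f| dμ` over a cell partition. -/
noncomputable def transferSum (μ ν : Measure X) (t : ℝ) (Z : Finset X) (C : X → Set X)
    (f : X → ℝ) : ℝ :=
  ∑ z ∈ Z, ν.real (Metric.ball z (1 / t)) / μ.real (Metric.ball z (1 / t)) *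
    ∫ y in C z, |f y| ∂μ

variable {μ ν : Measure X} [IsFiniteMeasure μ] [IsFiniteMeasure ν] {L : ℝ}

/-- On the `j`-th shell, doubling costs `L^(j+1)` for the total `ν`-mass of the cells and again for
replacing `1/μ(B_x)` by `1/μ(B_z)`. -/
theorem sum_cell_mul_localMean_le
    (hball : ∀ (x : X) (r : ℝ), MeasurableSet (Metric.ball x r))
    (hμ : IsDoublingMeasure μ L) (hν : IsDoublingMeasure ν L) (hL : 1 ≤ L) (hμ0 : μ ≠ 0)
    {κ : ℕ} (hκ : 2 * L ^ 4 ≤ 2 ^ κ) {f : X → ℝ} (hf : Integrable f μ) {t : ℝ} (ht : 0 < t)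
    {Z Ξ : Finset X} {ε η : ℝ} {C E : X → Set X} (hC : IsCellPartition Z ε C) (hε : ε ≤ 1 / t)
    (hE : IsCellPartition Ξ η E) (hη : η ≤ 1 / t) :
    ∑ x ∈ Ξ, ν.real (E x) * localMean μ κ t f x ≤
      2 ^ (κ + 1) * L ^ 4 * transferSum μ ν t Z C f := by
  have hL0 : 0 ≤ L := by linarith
  refine (sum_mul_localMean_le hball hf ht hC hε Ξ (fun x => ν.real (E x))
    (fun z => L ^ 4 * (ν.real (Metric.ball z (1 / t)) / μ.real (Metric.ball z (1 / t))))
    (fun _ _ => measureReal_nonneg) (fun _ _ => by positivity) (by positivity) hκ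
    fun z _ j => ?_).trans (le_of_eq ?_)
  · have hpos : ∀ x, 0 < μ.real (Metric.ball x (1 / t)) := fun x =>
      hμ.real_ball_pos hL0 hμ0 x (one_div_pos.2 ht)
    calc ∑ x ∈ Ξ with 1 + t * dist x z < 2 ^ (j + 1),
          ν.real (E x) / μ.real (Metric.ball x (1 / t))
        ≤ ∑ x ∈ Ξ with 1 + t * dist x z < 2 ^ (j + 1),
          ν.real (E x) * (L ^ (j + 1) / μ.real (Metric.ball z (1 / t))) := by
          refine Finset.sum_le_sum fun x hx => ?_
          rw [div_eq_mul_inv]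
          refine mul_le_mul_of_nonneg_left ?_ measureReal_nonneg
          rw [inv_eq_one_div, div_le_div_iff₀ (hpos x) (hpos z), one_mul]
          refine hμ.real_ball_le_of_shell hL0 ht ?_
          rw [dist_comm]
          exact (Finset.mem_filter.1 hx).2
      _ ≤ L ^ (j + 1) * ν.real (Metric.ball z (1 / t)) *
          (L ^ (j + 1) / μ.real (Metric.ball z (1 / t))) := by
          rw [← Finset.sum_mul]
          exact mul_le_mul_of_nonneg_right (hE.sum_real_shell_le hν hL0 ht hη z j)
            (by positivity)
      _ = L ^ (2 * (j + 1)) *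
          (ν.real (Metric.ball z (1 / t)) / μ.real (Metric.ball z (1 / t))) := by ring
      -- Weakened to the growth rate `L ^ 4` needed in the next lemma, so that one `κ` serves both.
      _ ≤ L ^ (4 * (j + 1)) *
          (ν.real (Metric.ball z (1 / t)) / μ.real (Metric.ball z (1 / t))) := by
          gcongr
          norm_num
      _ = _ := by rw [pow_mul, pow_succ]; ring
  · rw [transferSum, Finset.mul_sum, Finset.mul_sum]
    exact Finset.sum_congr rfl fun z _ => by ring

/-- Provides the self-bounding term in `transferSum_le`. Four doubling factors `L^(j+1)` occur: the
`μ`-mass of the cells, `ν(B_x)`, and `1/μ(B_x)` twice. This is the origin of the condition `2 * L ^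
4 ≤ 2 ^ κ`. -/
theorem sum_transfer_mul_localMean_le
    (hball : ∀ (x : X) (r : ℝ), MeasurableSet (Metric.ball x r))
    (hμ : IsDoublingMeasure μ L) (hν : IsDoublingMeasure ν L) (hL : 1 ≤ L) (hμ0 : μ ≠ 0)
    {κ : ℕ} (hκ : 2 * L ^ 4 ≤ 2 ^ κ) {f : X → ℝ} (hf : Integrable f μ) {t : ℝ} (ht : 0 < t)
    {Z : Finset X} {ε : ℝ} {C : X → Set X} (hC : IsCellPartition Z ε C) (hε : ε ≤ 1 / t) :
    ∑ x ∈ Z, ν.real (Metric.ball x (1 / t)) / μ.real (Metric.ball x (1 / t)) * μ.real (C x) *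
      localMean μ κ t f x ≤ 2 ^ (κ + 1) * L ^ 4 * transferSum μ ν t Z C f := by
  have hL0 : 0 ≤ L := by linarith
  refine (sum_mul_localMean_le hball hf ht hC hε Z
    (fun x => ν.real (Metric.ball x (1 / t)) / μ.real (Metric.ball x (1 / t)) * μ.real (C x))
    (fun z => L ^ 4 * (ν.real (Metric.ball z (1 / t)) / μ.real (Metric.ball z (1 / t))))
    (fun _ _ => by positivity) (fun _ _ => by positivity) (by positivity) hκ
    fun z _ j => ?_).trans (le_of_eq ?_)
  · have hpos : ∀ x, 0 < μ.real (Metric.ball x (1 / t)) := fun x =>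
      hμ.real_ball_pos hL0 hμ0 x (one_div_pos.2 ht)
    have hz := hpos z
    calc ∑ x ∈ Z with 1 + t * dist x z < 2 ^ (j + 1),
          ν.real (Metric.ball x (1 / t)) / μ.real (Metric.ball x (1 / t)) * μ.real (C x) /
            μ.real (Metric.ball x (1 / t))
        ≤ ∑ x ∈ Z with 1 + t * dist x z < 2 ^ (j + 1), μ.real (C x) *
          (L ^ (j + 1) * ν.real (Metric.ball z (1 / t)) *
            (L ^ (j + 1) / μ.real (Metric.ball z (1 / t))) ^ 2) := by
          refine Finset.sum_le_sum fun x hx => ?_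
          have hxj := (Finset.mem_filter.1 hx).2
          have h1 : (μ.real (Metric.ball x (1 / t)))⁻¹ ≤
              L ^ (j + 1) / μ.real (Metric.ball z (1 / t)) := by
            rw [inv_eq_one_div, div_le_div_iff₀ (hpos x) hz, one_mul]
            refine hμ.real_ball_le_of_shell hL0 ht ?_
            rwa [dist_comm]
          have h2 := hν.real_ball_le_of_shell hL0 ht hxj
          calc _ = μ.real (C x) * (ν.real (Metric.ball x (1 / t)) *
                (μ.real (Metric.ball x (1 / t)))⁻¹ ^ 2) := by ring
            _ ≤ _ := by gcongr
      _ ≤ (L ^ (j + 1) * μ.real (Metric.ball z (1 / t))) *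
          (L ^ (j + 1) * ν.real (Metric.ball z (1 / t)) *
            (L ^ (j + 1) / μ.real (Metric.ball z (1 / t))) ^ 2) := by
          rw [← Finset.sum_mul]
          exact mul_le_mul_of_nonneg_right (hC.sum_real_shell_le hμ hL0 ht hε z j)
            (by positivity)
      _ = (L ^ (j + 1)) ^ 4 *
          (ν.real (Metric.ball z (1 / t)) / μ.real (Metric.ball z (1 / t))) := by
          field_simp
      _ = _ := by ring
  · rw [transferSum, Finset.mul_sum, Finset.mul_sum]
    exact Finset.sum_congr rfl fun z _ => by ring

/-- The oscillation of `f` at scale `1 / t` is controlled by its local means. -/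
def HasLocalOscillation (μ : Measure X) (κ : ℕ) (t c δ : ℝ) (f : X → ℝ) : Prop :=
  ∀ x₁ x₂ : X, t * dist x₁ x₂ < δ →
    |f x₁ - f x₂| ≤ c * (t * dist x₁ x₂) * localMean μ κ t f x₂

theorem HasLocalOscillation.abs_sub_le {μ : Measure X} {κ : ℕ} {t c δ η : ℝ} {f : X → ℝ}
    (h : HasLocalOscillation μ κ t c δ f) (ht : 0 < t) (hc : 0 ≤ c) (hη : η ≤ δ) {x z : X}
    (hx : dist x z < η / t) : |f x - f z| ≤ c * η * localMean μ κ t f z := by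
  rw [lt_div_iff₀ ht, mul_comm] at hx
  refine (h x z (hx.trans_le hη)).trans ?_
  exact mul_le_mul_of_nonneg_right (mul_le_mul_of_nonneg_left hx.le hc)
    (localMean_nonneg μ κ ht f z)

/-- On a cell `|f|` is at most its `ν`-average plus an oscillation term. Integrated in `μ` and
summed, the oscillation terms give at most half of the transfer sum itself, which is finite and can
be absorbed. -/
theorem transferSum_le
    (hball : ∀ (x : X) (r : ℝ), MeasurableSet (Metric.ball x r))
    (hμ : IsDoublingMeasure μ L) (hν : IsDoublingMeasure ν L) (hL : 1 ≤ L) (hμ0 : μ ≠ 0)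
    (hν0 : ν ≠ 0) {κ : ℕ} (hκ : 2 * L ^ 4 ≤ 2 ^ κ) {c δ₁ δ : ℝ} (hc : 0 ≤ c) (hδ₁ : 0 < δ₁)
    (hδ₁' : δ₁ ≤ 1) (hδ : δ₁ ≤ δ) (hsmall : 2 * c * δ₁ * (2 ^ (κ + 1) * L ^ 4) ≤ 1 / 2)
    {k : ℕ} (hk : 1 ≤ 2 ^ k * (δ₁ / 2)) {f : X → ℝ} (hf : Integrable f μ) (hfν : Integrable f ν)
    {t : ℝ} (ht : 0 < t) (hosc : HasLocalOscillation μ κ t c δ f)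
    {Z : Finset X} {C : X → Set X} (hC : IsCellPartition Z (δ₁ / t) C) :
    transferSum μ ν t Z C f ≤ 2 * L ^ k * ∫ y, |f y| ∂ν := by
  have hL0 : 0 < L := by linarith
  have hε : δ₁ / t ≤ 1 / t := by gcongr
  have hcell : ∀ z ∈ Z, ν.real (Metric.ball z (1 / t)) / μ.real (Metric.ball z (1 / t)) *
      ∫ y in C z, |f y| ∂μ ≤ L ^ k * (∫ y in C z, |f y| ∂ν) + 2 * c * δ₁ *
        (ν.real (Metric.ball z (1 / t)) / μ.real (Metric.ball z (1 / t)) * μ.real (C z) *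
          localMean μ κ t f z) := by
    intro z hz
    have hμB : 0 < μ.real (Metric.ball z (1 / t)) :=
      hμ.real_ball_pos hL0.le hμ0 z (one_div_pos.2 ht)
    have hνC : 0 < ν.real (C z) :=
      (hν.real_ball_pos hL0.le hν0 z (half_pos (div_pos hδ₁ ht))).trans_le
        (measureReal_mono (hC.ball_subset z hz))
    have hνB : ν.real (Metric.ball z (1 / t)) ≤ L ^ k * ν.real (C z) := by
      refine (measureReal_mono (Metric.ball_subset_ball ?_)).trans
        ((hν.real_ball_pow_le hL0.le z (half_pos (div_pos hδ₁ ht)) k).trans ?_)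
      · rw [div_le_iff₀ ht]
        refine hk.trans (le_of_eq ?_)
        field_simp
      · exact mul_le_mul_of_nonneg_left (measureReal_mono (hC.ball_subset z hz)) (by positivity)
    have hμC : μ.real (C z) ≤ μ.real (Metric.ball z (1 / t)) :=
      measureReal_mono ((hC.subset_ball z hz).trans (Metric.ball_subset_ball hε))
    set I := ∫ y in C z, |f y| ∂ν
    have hI : 0 ≤ I := integral_nonneg fun _ => abs_nonneg _
    set O := localMean μ κ t f z
    have hpt : ∀ y ∈ C z, |f y| ≤ I / ν.real (C z) + 2 * c * δ₁ * O := by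
      intro y hy
      -- Pass through the centre `z` (hence the factor `2`), then average over `u` with respect to
      -- `ν`.
      have hu : ∀ u ∈ C z, |f y| - 2 * c * δ₁ * O ≤ |f u| := by
        intro u hu
        have h1 := hosc.abs_sub_le ht hc hδ (hC.subset_ball z hz hy)
        have h2 := hosc.abs_sub_le ht hc hδ (hC.subset_ball z hz hu)
        rw [abs_sub_comm] at h2
        have h3 := abs_sub_abs_le_abs_sub (f y) (f z)
        have h4 := abs_sub_abs_le_abs_sub (f z) (f u)
        linarith
      have := setIntegral_mono_on (integrableOn_const (measure_ne_top ν (C z)))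
        hfν.abs.integrableOn (hC.measurableSet z hz) hu
      rw [setIntegral_const, smul_eq_mul, mul_comm] at this
      have := (le_div_iff₀ hνC).2 this
      linarith
    have hF : ∫ y in C z, |f y| ∂μ ≤ μ.real (C z) * (I / ν.real (C z) + 2 * c * δ₁ * O) := by
      have := setIntegral_mono_on hf.abs.integrableOn
        (integrableOn_const (measure_ne_top μ (C z))) (hC.measurableSet z hz) hpt
      rwa [setIntegral_const, smul_eq_mul] at this
    calc _ ≤ ν.real (Metric.ball z (1 / t)) / μ.real (Metric.ball z (1 / t)) *
          (μ.real (C z) * (I / ν.real (C z) + 2 * c * δ₁ * O)) := by gcongr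
      _ = (ν.real (Metric.ball z (1 / t)) / ν.real (C z)) *
          (μ.real (C z) / μ.real (Metric.ball z (1 / t))) * I + 2 * c * δ₁ *
        (ν.real (Metric.ball z (1 / t)) / μ.real (Metric.ball z (1 / t)) * μ.real (C z) * O) := by
          ring
      _ ≤ L ^ k * 1 * I + 2 * c * δ₁ *
        (ν.real (Metric.ball z (1 / t)) / μ.real (Metric.ball z (1 / t)) * μ.real (C z) * O) := by
          gcongr
          · rwa [div_le_iff₀ hνC]
          · rwa [div_le_one hμB]
      _ = _ := by ring
  have hQ := Finset.sum_le_sum hcell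
  rw [Finset.sum_add_distrib, ← Finset.mul_sum, ← Finset.mul_sum,
    ← hC.integral_eq_sum hfν.abs] at hQ
  have hmean := sum_transfer_mul_localMean_le hball hμ hν hL hμ0 hκ hf ht hC hε
  have hQ0 : 0 ≤ transferSum μ ν t Z C f := Finset.sum_nonneg fun z _ =>
    mul_nonneg (by positivity) (integral_nonneg fun _ => abs_nonneg _)
  have h1 := mul_le_mul_of_nonneg_left hmean (show 0 ≤ 2 * c * δ₁ by positivity)
  have h2 := mul_le_mul_of_nonneg_right hsmall hQ0
  change transferSum μ ν t Z C f ≤ _ at hQ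
  linarith

/-- A Marcinkiewicz–Zygmund inequality: the error of the Riemann sum over a fine cell partition
is at most a multiple of `δ` times the `L¹` norm. -/
theorem exists_sum_integral_abs_sub_le
    (hball : ∀ (x : X) (r : ℝ), MeasurableSet (Metric.ball x r))
    (hμ : IsDoublingMeasure μ L) (hν : IsDoublingMeasure ν L) (hL : 1 ≤ L) (hμ0 : μ ≠ 0)
    (hν0 : ν ≠ 0) {κ : ℕ} (hκ : 2 * L ^ 4 ≤ 2 ^ κ) {c δ₀ : ℝ} (hc : 0 < c) (hδ₀ : 0 < δ₀) :
    ∃ K : ℝ, 0 < K ∧ ∀ t : ℝ, 0 < t → ∀ f : X → ℝ, Integrable f μ → Integrable f ν →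
      HasLocalOscillation μ κ t c δ₀ f → ∀ δ : ℝ, 0 < δ → δ ≤ 1 → δ ≤ δ₀ →
      ∀ (Ξ : Finset X) (E : X → Set X), IsCellPartition Ξ (δ / t) E →
        ∑ z ∈ Ξ, ∫ y in E z, |f y - f z| ∂ν ≤ K * δ * ∫ y, |f y| ∂ν := by
  have hL0 : 0 < L := by linarith
  set A : ℝ := 2 ^ (κ + 1) * L ^ 4
  have hA : 0 < A := by positivity
  -- The last bound makes the absorbed coefficient `2cδ₁A` at most `1/2`. As `δ₁` does not involve
  -- `δ` or `t`, neither does `K`.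
  set δ₁ : ℝ := min (min 1 δ₀) (1 / (4 * c * A))
  have hδ₁ : 0 < δ₁ := by positivity
  have hδ₁1 : δ₁ ≤ 1 := (min_le_left _ _).trans (min_le_left _ _)
  have hδ₁0 : δ₁ ≤ δ₀ := (min_le_left _ _).trans (min_le_right _ _)
  have hsmall : 2 * c * δ₁ * A ≤ 1 / 2 := by
    have : δ₁ ≤ 1 / (4 * c * A) := min_le_right _ _
    rw [le_div_iff₀ (by positivity)] at this
    linarith
  obtain ⟨k, hk⟩ := pow_unbounded_of_one_lt (1 / (δ₁ / 2)) (one_lt_two (α := ℝ))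
  rw [div_lt_iff₀ (half_pos hδ₁)] at hk
  refine ⟨c * (A * (2 * L ^ k)), by positivity, ?_⟩
  intro t ht f hf hfν hosc δ hδ hδ1 hδδ₀ Ξ E hE
  obtain ⟨Z, hZsep, hZcov⟩ := exists_maximal_separated (X := X) (div_pos hδ₁ ht)
  have hZfin := hμ.finite_of_separated hL0 hμ0 hball (div_pos hδ₁ ht) hZsep
  obtain ⟨Z, rfl⟩ := hZfin.exists_finset_coe
  obtain ⟨C, hC⟩ := exists_isCellPartition hball (div_pos hδ₁ ht) hZsep hZcov
  have hQ := transferSum_le hball hμ hν hL hμ0 hν0 hκ hc.le hδ₁ hδ₁1 hδ₁0 hsmall hk.le hf hfν ht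
    hosc hC
  have hmean := sum_cell_mul_localMean_le hball hμ hν hL hμ0 hκ hf ht hC
    (by gcongr) hE (by gcongr)
  calc ∑ z ∈ Ξ, ∫ y in E z, |f y - f z| ∂ν
      ≤ ∑ z ∈ Ξ, c * δ * (ν.real (E z) * localMean μ κ t f z) := by
        refine Finset.sum_le_sum fun z hz => ?_
        have := setIntegral_mono_on (hfν.sub (integrable_const (f z))).abs.integrableOn
          (integrableOn_const (measure_ne_top ν (E z))) (hE.measurableSet z hz)
          fun y hy => hosc.abs_sub_le ht hc.le hδδ₀ (hE.subset_ball z hz hy)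
        rw [setIntegral_const, smul_eq_mul] at this
        refine this.trans (le_of_eq (by ring))
    _ = c * δ * ∑ z ∈ Ξ, ν.real (E z) * localMean μ κ t f z := by rw [Finset.mul_sum]
    _ ≤ c * δ * (A * (2 * L ^ k * ∫ y, |f y| ∂ν)) := by
        refine mul_le_mul_of_nonneg_left (hmean.trans ?_) (by positivity)
        exact mul_le_mul_of_nonneg_left hQ hA.le
    _ = _ := by ring

/-- Positive quadrature on a doubling space, for spaces of functions whose oscillation is
controlled by local means. -/
theorem exists_positive_quadrature
    (hball : ∀ (x : X) (r : ℝ), MeasurableSet (Metric.ball x r))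
    (hμ : IsDoublingMeasure μ L) (hν : IsDoublingMeasure ν L) (hL : 1 ≤ L) (hμ0 : μ ≠ 0)
    (hν0 : ν ≠ 0) {κ : ℕ} (hκ : 2 * L ^ 4 ≤ 2 ^ κ) {c δs : ℝ} (hc : 0 < c) (hδs : 0 < δs) :
    ∃ δ₀ : ℝ, 0 < δ₀ ∧ ∀ t : ℝ, 0 < t → ∀ V : Submodule ℝ (X → ℝ),
      (∀ f ∈ V, Integrable f μ ∧ Integrable f ν ∧ HasLocalOscillation μ κ t c δs f) →
      ∀ δ : ℝ, 0 < δ → δ < δ₀ → ∀ Ξ : Finset X,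
      ((Ξ : Set X).Pairwise fun x y => δ / t ≤ dist x y) → (∀ x, ∃ z ∈ Ξ, dist x z < δ / t) →
      ∃ lam : X → ℝ, (∀ f ∈ V, ∫ y, f y ∂ν = ∑ z ∈ Ξ, lam z * f z) ∧
        ∀ z ∈ Ξ, 1 / (2 * L) * ν.real (Metric.ball z (δ / t)) ≤ lam z ∧
          lam z ≤ 3 / 2 * ν.real (Metric.ball z (δ / t)) := by
  have hL0 : 0 < L := by linarith
  obtain ⟨K, hK, hMZ⟩ := exists_sum_integral_abs_sub_le hball hμ hν hL hμ0 hν0 hκ hc hδs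
  -- With `Kδ < 1/3`, the error `S` is at most a third of `‖f‖`, and `‖f‖ ≤ S + ∑ ν(E_z)|f(z)|`;
  -- hence `S ≤ ½ ∑ ν(E_z)|f(z)|`.
  refine ⟨min (min 1 δs) (1 / (3 * K)), by positivity, ?_⟩
  intro t ht V hV δ hδ hδ₀ Ξ hsep hcov
  obtain ⟨hδ', hδK⟩ := lt_min_iff.1 hδ₀
  obtain ⟨hδ1, hδs'⟩ := lt_min_iff.1 hδ'
  rw [lt_div_iff₀ (by positivity)] at hδK
  obtain ⟨E, hE⟩ := exists_isCellPartition hball (div_pos hδ ht) hsep hcov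
  let Φ : V →ₗ[ℝ] ℝ :=
    { toFun := fun f => ∫ y, f.1 y ∂ν - ∑ z ∈ Ξ, ν.real (E z) * f.1 z
      map_add' := fun f g => by
        simp only [Submodule.coe_add, Pi.add_apply, mul_add, Finset.sum_add_distrib]
        rw [integral_add (hV f.1 f.2).2.1 (hV g.1 g.2).2.1]
        ring
      map_smul' := fun r f => by
        simp only [Submodule.coe_smul, Pi.smul_apply, smul_eq_mul, RingHom.id_apply]
        rw [integral_const_mul, mul_sub, Finset.mul_sum]
        congr 1
        exact Finset.sum_congr rfl fun _ _ => by ring }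
  have hΦ : ∀ f : V, |Φ f| ≤ ∑ z ∈ Ξ, (1 / 2 * ν.real (E z)) * |f.1 z| := by
    intro f
    obtain ⟨hfμ, hfν, hosc⟩ := hV f.1 f.2
    set S := ∑ z ∈ Ξ, ∫ y in E z, |f.1 y - f.1 z| ∂ν
    have hS : S ≤ K * δ * ∫ y, |f.1 y| ∂ν := hMZ t ht f.1 hfμ hfν hosc δ hδ hδ1.le hδs'.le Ξ E hE
    have hint : ∀ z, IntegrableOn (fun y => |f.1 y - f.1 z|) (E z) ν := fun z =>
      (hfν.sub (integrable_const (f.1 z))).abs.integrableOn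
    have h1 : |Φ f| ≤ S := by
      change |∫ y, f.1 y ∂ν - ∑ z ∈ Ξ, ν.real (E z) * f.1 z| ≤ S
      rw [hE.integral_eq_sum hfν, ← Finset.sum_sub_distrib]
      refine (Finset.abs_sum_le_sum_abs _ _).trans (Finset.sum_le_sum fun z _ => ?_)
      have : ∫ y in E z, f.1 y ∂ν - ν.real (E z) * f.1 z = ∫ y in E z, (f.1 y - f.1 z) ∂ν := by
        rw [integral_sub hfν.integrableOn (integrableOn_const (measure_ne_top ν (E z))),
          setIntegral_const, smul_eq_mul]
      rw [this]
      exact abs_integral_le_integral_abs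
    have h2 : ∫ y, |f.1 y| ∂ν ≤ S + ∑ z ∈ Ξ, ν.real (E z) * |f.1 z| := by
      rw [hE.integral_eq_sum hfν.abs, ← Finset.sum_add_distrib]
      refine Finset.sum_le_sum fun z hz => ?_
      have := setIntegral_mono_on hfν.abs.integrableOn
        ((hint z).add (integrableOn_const (C := |f.1 z|) (measure_ne_top ν (E z))))
        (hE.measurableSet z hz) fun y _ => by
          have := abs_add_le (f.1 y - f.1 z) (f.1 z)
          rwa [sub_add_cancel] at this
      refine this.trans (le_of_eq ?_)
      rw [integral_add' (hint z) (integrableOn_const (measure_ne_top ν (E z))),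
        setIntegral_const, smul_eq_mul]
    have h3 : ∑ z ∈ Ξ, (1 / 2 * ν.real (E z)) * |f.1 z| =
        1 / 2 * ∑ z ∈ Ξ, ν.real (E z) * |f.1 z| := by
      rw [Finset.mul_sum]
      exact Finset.sum_congr rfl fun _ _ => by ring
    rw [h3]
    have h4 : 0 ≤ ∫ y, |f.1 y| ∂ν := integral_nonneg fun _ => abs_nonneg _
    nlinarith
  obtain ⟨b, hb, hbΦ⟩ := exists_coeff_of_abs_le V Φ Ξ _ (fun _ _ => by positivity) hΦ
  refine ⟨fun z => ν.real (E z) + b z, fun f hf => ?_, fun z hz => ?_⟩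
  · have : ∫ y, f y ∂ν - ∑ z ∈ Ξ, ν.real (E z) * f z = ∑ z ∈ Ξ, b z * f z := hbΦ ⟨f, hf⟩
    simp only [add_mul, Finset.sum_add_distrib]
    linarith
  · have h1 := abs_le.1 (hb z hz)
    have h2 : ν.real (E z) ≤ ν.real (Metric.ball z (δ / t)) :=
      measureReal_mono (hE.subset_ball z hz)
    have h3 : 1 / (2 * L) * ν.real (Metric.ball z (δ / t)) ≤ 1 / 2 * ν.real (E z) := by
      have h4 := hν z (δ / t / 2) (by positivity)
      rw [mul_div_cancel₀ _ (two_ne_zero)] at h4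
      have h5 : ν.real (Metric.ball z (δ / t / 2)) ≤ ν.real (E z) :=
        measureReal_mono (hE.ball_subset z hz)
      rw [div_mul_eq_mul_div, one_mul, div_le_iff₀ (by positivity)]
      nlinarith
    exact ⟨by linarith [h1.1], by linarith [h1.2]⟩

end Core

end LocHom

namespace LocHom

/-! ### Weights as finite measures. -/

section WeightMeasure

variable {X : Type*} [MeasurableSpace X] {m : Measure X} {w : X → ℝ}

/-- The measure `w dm`. -/
noncomputable def weightMeasure (m : Measure X) (w : X → ℝ) : Measure X :=
  m.withDensity fun x => ENNReal.ofReal (w x)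

theorem isFiniteMeasure_weightMeasure (hw : Integrable w m) :
    IsFiniteMeasure (weightMeasure m w) :=
  isFiniteMeasure_withDensity_ofReal hw.hasFiniteIntegral

theorem integral_weightMeasure (hw : Integrable w m) (h0 : ∀ x, 0 ≤ w x) (f : X → ℝ) :
    ∫ x, f x ∂(weightMeasure m w) = ∫ x, f x * w x ∂m := by
  rw [weightMeasure, integral_withDensity_eq_integral_toReal_smul₀
    hw.aestronglyMeasurable.aemeasurable.ennreal_ofReal (ae_of_all _ fun _ => ENNReal.ofReal_lt_top)]
  simp only [ENNReal.toReal_ofReal (h0 _), smul_eq_mul, mul_comm]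

theorem integrable_weightMeasure (hw : Integrable w m) (h0 : ∀ x, 0 ≤ w x) (f : X → ℝ) :
    Integrable f (weightMeasure m w) ↔ Integrable (fun x => f x * w x) m := by
  rw [weightMeasure, integrable_withDensity_iff_integrable_smul₀'
    hw.aestronglyMeasurable.aemeasurable.ennreal_ofReal (ae_of_all _ fun _ => ENNReal.ofReal_lt_top)]
  simp only [ENNReal.toReal_ofReal (h0 _), smul_eq_mul, mul_comm]

theorem weightMeasure_real (hw : Integrable w m) (h0 : ∀ x, 0 ≤ w x) {A : Set X}
    (hA : MeasurableSet A) : (weightMeasure m w).real A = ∫ x in A, w x ∂m := by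
  rw [measureReal_def, weightMeasure, withDensity_apply _ hA,
    ← ofReal_integral_eq_lintegral_ofReal hw.integrableOn (ae_of_all _ h0),
    ENNReal.toReal_ofReal (integral_nonneg h0)]

theorem weightMeasure_ne_zero (hw : Integrable w m) (h0 : ∀ x, 0 ≤ w x)
    (hpos : 0 < ∫ x, w x ∂m) : weightMeasure m w ≠ 0 := by
  intro h
  have := weightMeasure_real hw h0 MeasurableSet.univ
  rw [h, setIntegral_univ] at this
  simp at this
  linarith

end WeightMeasure

/-! ### Orthogonal polynomials and the reproducing property of `L_n`. -/

section Polynomials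

variable {D : ℕ} {Ω : Set (Fin D → ℝ)} {m : Measure Ω} {ϖ : Ω → ℝ}

theorem polySpace_mono {k n : ℕ} (h : k ≤ n) : polySpace Ω k ≤ polySpace Ω n := by
  refine Submodule.map_mono fun p hp => ?_
  rw [MvPolynomial.mem_restrictTotalDegree] at hp ⊢
  exact hp.trans h

instance (n : ℕ) : FiniteDimensional ℝ (polySpace Ω n) := by
  unfold polySpace
  infer_instance

theorem one_mem_polySpace (n : ℕ) : (fun _ : Ω => (1 : ℝ)) ∈ polySpace Ω n := by
  refine ⟨1, ?_, ?_⟩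
  · change (1 : MvPolynomial (Fin D) ℝ) ∈ MvPolynomial.restrictTotalDegree (Fin D) ℝ n
    rw [MvPolynomial.mem_restrictTotalDegree]
    simp
  · ext x
    simp [polyRestrict]

theorem measurable_of_mem_polySpace {n : ℕ} {f : Ω → ℝ} (hf : f ∈ polySpace Ω n) :
    Measurable f := by
  obtain ⟨p, -, rfl⟩ := hf
  exact (p.continuous_eval.comp continuous_subtype_val).measurable

/-- Polarization, since integrability is given only for squares. -/
theorem IsPolyInnerProduct.integrable_mul (h : IsPolyInnerProduct m ϖ) {n : ℕ} {f g : Ω → ℝ}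
    (hf : f ∈ polySpace Ω n) (hg : g ∈ polySpace Ω n) :
    Integrable (fun x => f x * g x * ϖ x) m := by
  have h1 := (h n _ (add_mem hf hg)).1
  have h2 := (h n _ hf).1
  have h3 := (h n _ hg).1
  refine (((h1.sub h2).sub h3).const_mul (1 / 2)).congr (ae_of_all _ fun x => ?_)
  simp only [Pi.sub_apply, Pi.add_apply]
  ring

theorem IsPolyInnerProduct.integrable_weight_mul (h : IsPolyInnerProduct m ϖ) {n : ℕ} {f : Ω → ℝ}
    (hf : f ∈ polySpace Ω n) : Integrable (fun x => f x * ϖ x) m := by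
  simpa using h.integrable_mul hf (one_mem_polySpace n)

theorem wInner_comm (f g : Ω → ℝ) : wInner m ϖ f g = wInner m ϖ g f := by
  simp only [wInner, mul_comm (f _)]

theorem IsPolyInnerProduct.wInner_add_left (h : IsPolyInnerProduct m ϖ) {n : ℕ}
    {f f' g : Ω → ℝ} (hf : f ∈ polySpace Ω n) (hf' : f' ∈ polySpace Ω n)
    (hg : g ∈ polySpace Ω n) : wInner m ϖ (f + f') g = wInner m ϖ f g + wInner m ϖ f' g := by
  unfold wInner
  rw [← integral_add (h.integrable_mul hf hg) (h.integrable_mul hf' hg)]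
  simp only [Pi.add_apply, add_mul]

theorem wInner_smul_left (c : ℝ) (f g : Ω → ℝ) :
    wInner m ϖ (c • f) g = c * wInner m ϖ f g := by
  unfold wInner
  rw [← integral_const_mul]
  simp only [Pi.smul_apply, smul_eq_mul, mul_assoc]

theorem IsPolyInnerProduct.wInner_add_right (h : IsPolyInnerProduct m ϖ) {n : ℕ}
    {f g g' : Ω → ℝ} (hf : f ∈ polySpace Ω n) (hg : g ∈ polySpace Ω n)
    (hg' : g' ∈ polySpace Ω n) : wInner m ϖ f (g + g') = wInner m ϖ f g + wInner m ϖ f g' := by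
  rw [wInner_comm, h.wInner_add_left hg hg' hf, wInner_comm g, wInner_comm g']

theorem wInner_smul_right (c : ℝ) (f g : Ω → ℝ) :
    wInner m ϖ f (c • g) = c * wInner m ϖ f g := by
  rw [wInner_comm, wInner_smul_left, wInner_comm]

theorem IsPolyInnerProduct.wInner_sum_right (h : IsPolyInnerProduct m ϖ) {n : ℕ} {ι : Type*}
    (s : Finset ι) {f : Ω → ℝ} {g : ι → Ω → ℝ} (hf : f ∈ polySpace Ω n)
    (hg : ∀ i ∈ s, g i ∈ polySpace Ω n) :
    wInner m ϖ f (∑ i ∈ s, g i) = ∑ i ∈ s, wInner m ϖ f (g i) := by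
  unfold wInner
  rw [← integral_finsetSum s fun i hi => h.integrable_mul hf (hg i hi)]
  simp only [Finset.sum_apply, Finset.mul_sum, Finset.sum_mul]

/-- Riesz representation on subspaces of polynomials. -/
theorem IsPolyInnerProduct.exists_representer (h : IsPolyInnerProduct m ϖ) {n : ℕ}
    (U : Submodule ℝ (Ω → ℝ)) (hU : U ≤ polySpace Ω n) (φ : U →ₗ[ℝ] ℝ) :
    ∃ p ∈ U, ∀ f : U, wInner m ϖ f.1 p = φ f := by
  have : FiniteDimensional ℝ U := Submodule.finiteDimensional_of_le hU
  let B : U →ₗ[ℝ] Module.Dual ℝ U := LinearMap.mk₂ ℝ (fun p f => wInner m ϖ f.1 p.1)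
    (fun p q f => h.wInner_add_right (hU f.2) (hU p.2) (hU q.2))
    (fun c p f => wInner_smul_right c f.1 p.1)
    (fun p f g => h.wInner_add_left (hU f.2) (hU g.2) (hU p.2))
    (fun c p f => wInner_smul_left c f.1 p.1)
  -- Definiteness gives injectivity, and equality of dimensions then gives surjectivity.
  have hinj : Function.Injective B := by
    refine (injective_iff_map_eq_zero B).2 fun p hp => Subtype.ext ?_
    exact (h n p.1 (hU p.2)).2 (LinearMap.congr_fun hp p)
  obtain ⟨p, hp⟩ := (LinearMap.injective_iff_surjective_of_finrank_eq_finrank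
    Subspace.dual_finrank_eq.symm).1 hinj φ
  exact ⟨p.1, p.2, fun f => LinearMap.congr_fun hp f⟩

/-- The orthogonal polynomials of degree `n` as a subspace. -/
def IsPolyInnerProduct.orthSubmodule (h : IsPolyInnerProduct m ϖ) (n : ℕ) :
    Submodule ℝ (Ω → ℝ) where
  carrier := orthPoly m ϖ n
  add_mem' := fun hf hg => ⟨add_mem hf.1 hg.1, fun k hk p hp => by
    rw [h.wInner_add_left hf.1 hg.1 (polySpace_mono hk.le hp), hf.2 k hk p hp, hg.2 k hk p hp,
      add_zero]⟩
  zero_mem' := ⟨zero_mem _, fun k _ p _ => by simp [wInner]⟩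
  smul_mem' := fun c f hf => ⟨Submodule.smul_mem _ c hf.1, fun k hk p hp => by
    rw [wInner_smul_left, hf.2 k hk p hp, mul_zero]⟩

theorem IsPolyInnerProduct.reproKernel_spec (h : IsPolyInnerProduct m ϖ) (n : ℕ) (x : Ω) :
    reproKernel m ϖ n x ∈ orthPoly m ϖ n ∧
      ∀ f ∈ orthPoly m ϖ n, wInner m ϖ f (reproKernel m ϖ n x) = f x := by
  obtain ⟨p, hp, hpf⟩ := h.exists_representer (h.orthSubmodule n) (n := n) (fun f hf => hf.1)
    ((LinearMap.proj x).comp (h.orthSubmodule n).subtype)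
  exact Classical.epsilon_spec (p := fun p : Ω → ℝ =>
    p ∈ orthPoly m ϖ n ∧ ∀ f ∈ orthPoly m ϖ n, wInner m ϖ f p = f x)
    ⟨p, hp, fun f hf => hpf ⟨f, hf⟩⟩

theorem wInner_eq_zero_of_mem_orthPoly {j k : ℕ} (hjk : j ≠ k) {f g : Ω → ℝ}
    (hf : f ∈ orthPoly m ϖ j) (hg : g ∈ orthPoly m ϖ k) : wInner m ϖ f g = 0 := by
  rcases lt_or_gt_of_ne hjk with hlt | hlt
  · rw [wInner_comm]
    exact hg.2 j hlt f hf.1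
  · exact hf.2 k hlt g hg.1

theorem locKernel_eq_sum (a : ℝ → ℝ) (n : ℕ) (x : Ω) :
    locKernel m ϖ a n x =
      ∑ k ∈ Finset.range (2 * n + 1), a ((k : ℝ) / (n : ℝ)) • reproKernel m ϖ k x := by
  ext y
  simp [locKernel, Finset.sum_apply]

theorem IsPolyInnerProduct.smul_reproKernel_mem (h : IsPolyInnerProduct m ϖ) (c : ℝ) {k n : ℕ}
    (hk : k ∈ Finset.range (2 * n + 1)) (x : Ω) :
    c • reproKernel m ϖ k x ∈ polySpace Ω (2 * n) :=
  Submodule.smul_mem _ _ (polySpace_mono (Nat.lt_succ_iff.1 (Finset.mem_range.1 hk))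
    (h.reproKernel_spec k x).1.1)

theorem IsPolyInnerProduct.locKernel_mem (h : IsPolyInnerProduct m ϖ) (a : ℝ → ℝ) (n : ℕ)
    (x : Ω) : locKernel m ϖ a n x ∈ polySpace Ω (2 * n) := by
  rw [locKernel_eq_sum]
  exact Submodule.sum_mem _ fun k hk => h.smul_reproKernel_mem _ hk x

/-- By orthogonality only the term `k = j` survives, and its cut-off factor is `1` because `j/n ≤
1`. -/
theorem IsPolyInnerProduct.wInner_locKernel_of_mem_orthPoly (h : IsPolyInnerProduct m ϖ)
    {a : ℝ → ℝ} (ha : IsCutoffA a) {n j : ℕ} (hn : 1 ≤ n) (hj : j ≤ n) {f : Ω → ℝ}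
    (hf : f ∈ orthPoly m ϖ j) (x : Ω) : wInner m ϖ f (locKernel m ϖ a n x) = f x := by
  have hn' : (0 : ℝ) < n := by exact_mod_cast hn
  rw [locKernel_eq_sum, h.wInner_sum_right (n := 2 * n) _ (polySpace_mono (by omega) hf.1)
    fun k hk => h.smul_reproKernel_mem _ hk x, Finset.sum_eq_single j]
  · rw [wInner_smul_right, (h.reproKernel_spec j x).2 f hf, ha.eq_one, one_mul]
    refine ⟨by positivity, ?_⟩
    rw [div_le_one hn']
    exact_mod_cast hj
  · intro k _ hk
    rw [wInner_smul_right, wInner_eq_zero_of_mem_orthPoly hk.symm hf (h.reproKernel_spec k x).1,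
      mul_zero]
  · intro hj'
    exact absurd (Finset.mem_range.2 (by omega)) hj'

/-- The kernel `L_n` reproduces polynomials of degree at most `n`. -/
theorem IsPolyInnerProduct.wInner_locKernel (h : IsPolyInnerProduct m ϖ)
    {a : ℝ → ℝ} (ha : IsCutoffA a) {n : ℕ} (hn : 1 ≤ n) (x : Ω) (j : ℕ) (hj : j ≤ n) {f : Ω → ℝ}
    (hf : f ∈ polySpace Ω j) : wInner m ϖ f (locKernel m ϖ a n x) = f x := by
  induction j generalizing f with
  | zero =>
    exact h.wInner_locKernel_of_mem_orthPoly ha hn hj ⟨hf, fun k hk => absurd hk (by omega)⟩ x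
  | succ j ih =>
    have hle : polySpace Ω j ≤ polySpace Ω (j + 1) := polySpace_mono (by omega)
    -- `p` is the orthogonal projection of `f` onto `Π_j`, so `f - p` is an orthogonal polynomial of
    -- degree `j + 1`.
    obtain ⟨p, hp, hpf⟩ := h.exists_representer (polySpace Ω j) le_rfl
      { toFun := fun g => wInner m ϖ g.1 f
        map_add' := fun g g' => h.wInner_add_left (hle g.2) (hle g'.2) hf
        map_smul' := fun c g => wInner_smul_left c g.1 f }
    have hsub : f + (-1 : ℝ) • p ∈ polySpace Ω (j + 1) :=
      add_mem hf (Submodule.smul_mem _ _ (hle hp))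
    have horth : f + (-1 : ℝ) • p ∈ orthPoly m ϖ (j + 1) := by
      refine ⟨hsub, fun k hk g hg => ?_⟩
      have hg' : g ∈ polySpace Ω j := polySpace_mono (by omega) hg
      have hgf : wInner m ϖ g p = wInner m ϖ g f := hpf ⟨g, hg'⟩
      rw [h.wInner_add_left hf (Submodule.smul_mem _ _ (hle hp)) (hle hg'), wInner_smul_left,
        wInner_comm f, wInner_comm p, hgf]
      ring
    have h1 := h.wInner_locKernel_of_mem_orthPoly ha hn hj horth x
    rw [h.wInner_add_left (n := 2 * n) (polySpace_mono (by omega) hf)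
      (Submodule.smul_mem _ _ (polySpace_mono (by omega) hp)) (h.locKernel_mem a n x),
      wInner_smul_left, ih (by omega) hp] at h1
    simp only [Pi.add_apply, Pi.smul_apply, smul_eq_mul] at h1
    linarith

end Polynomials

/-! ### Consequences of kernel localization. -/

section Localizable

variable {D : ℕ} {Ω : Set (Fin D → ℝ)} {ρ : MetricSpace Ω} {m : Measure Ω} {ϖ : Ω → ℝ}
  {a : ℝ → ℝ}

/-- `Ω` also carries the Euclidean metric as a subtype, so the structure from `ρ` is passed
explicitly. -/
theorem ball_eq_dBall (ρ : MetricSpace Ω) (x : Ω) (r : ℝ) :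
    @Metric.ball Ω ρ.toPseudoMetricSpace x r = dBall ρ x r := by
  let := ρ.toPseudoMetricSpace
  ext y
  change dist y x < r ↔ dist x y < r
  rw [dist_comm]

theorem IsHomogeneousDomain.measurableSet_metricBall (hΩ : IsHomogeneousDomain ρ m) (x : Ω)
    (r : ℝ) : MeasurableSet (@Metric.ball Ω ρ.toPseudoMetricSpace x r) := by
  rw [ball_eq_dBall]
  exact hΩ.measurableSet_ball x r

theorem IsDoublingWeight.real_ball_eq {w : Ω → ℝ} (hw : IsDoublingWeight ρ m w)
    (hΩ : IsHomogeneousDomain ρ m) (x : Ω) (r : ℝ) :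
    (weightMeasure m w).real (@Metric.ball Ω ρ.toPseudoMetricSpace x r) =
      wMass m w (dBall ρ x r) := by
  rw [ball_eq_dBall, weightMeasure_real hw.integrable hw.nonneg (hΩ.measurableSet_ball x r), wMass]

theorem IsDoublingWeight.exists_isDoublingMeasure {w : Ω → ℝ} (hw : IsDoublingWeight ρ m w)
    (hΩ : IsHomogeneousDomain ρ m) :
    ∃ L : ℝ, 1 ≤ L ∧ @IsDoublingMeasure Ω ρ.toPseudoMetricSpace _ (weightMeasure m w) L := by
  let := ρ.toPseudoMetricSpace
  obtain ⟨L, -, hL⟩ := hw.doubling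
  have h : IsDoublingMeasure (weightMeasure m w) L := by
    intro x r hr
    rw [hw.real_ball_eq hΩ, hw.real_ball_eq hΩ]
    exact hL x r hr
  exact ⟨max 1 L, le_max_left _ _, h.mono (le_max_right _ _)⟩

/-- Polynomials are bounded on a localizable space. -/
theorem IsLocalizable.exists_abs_le (hϖ : IsLocalizable ρ m ϖ a) (hΩ : IsHomogeneousDomain ρ m)
    (ha : IsCutoffA a) {n : ℕ} (hn : 1 ≤ n) {f : Ω → ℝ} (hf : f ∈ polySpace Ω n) :
    ∃ B : ℝ, ∀ x, |f x| ≤ B := by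
  let := ρ.toPseudoMetricSpace
  have hW := hϖ.doublingWeight
  have := isFiniteMeasure_weightMeasure hW.integrable
  have hn' : (0 : ℝ) < n := by exact_mod_cast hn
  obtain ⟨L, hL, hd⟩ := hW.exists_isDoublingMeasure hΩ
  obtain ⟨b, hb, hbx⟩ := hd.exists_le_real_ball (by linarith)
    (weightMeasure_ne_zero hW.integrable hW.nonneg hW.integral_pos)
    hΩ.measurableSet_metricBall (one_div_pos.2 hn')
  simp only [hW.real_ball_eq hΩ] at hbx
  obtain ⟨c, hc, hker⟩ := hϖ.assertion1 1 one_pos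
  have hIP := hϖ.innerProduct
  -- Masses of balls of radius `1/n` are at least `b`, so for fixed `n` the kernel is bounded by `c
  -- / b`.
  refine ⟨∫ y, |f y * ϖ y| * (c / b) ∂m, fun x => ?_⟩
  rw [← hIP.wInner_locKernel ha hn x n le_rfl hf, wInner]
  refine abs_integral_le_integral_abs.trans (integral_mono
    (hIP.integrable_mul (n := 2 * n) (polySpace_mono (by omega) hf) (hIP.locKernel_mem a n x)).abs
    ((hIP.integrable_weight_mul hf).abs.mul_const _) fun y => ?_)
  have h1 : |locKernel m ϖ a n x y| ≤ c / b := by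
    refine (hker n hn x y).trans (div_le_div_of_nonneg_left hc.le hb ?_)
    have hsx := Real.sqrt_le_sqrt (hbx x)
    have hsy := Real.sqrt_le_sqrt (hbx y)
    have h2 : b ≤ √(wMass m ϖ (dBall ρ x (1 / n))) * √(wMass m ϖ (dBall ρ y (1 / n))) := by
      calc b = √b * √b := (Real.mul_self_sqrt hb.le).symm
        _ ≤ _ := mul_le_mul hsx hsy (Real.sqrt_nonneg _) (Real.sqrt_nonneg _)
    have h3 : 1 ≤ (1 + n * ρ.dist x y) ^ (1 : ℝ) := by
      rw [Real.rpow_one]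
      have : 0 ≤ (n : ℝ) * ρ.dist x y := mul_nonneg hn'.le (dist_nonneg (x := x) (y := y))
      linarith
    nlinarith
  calc |f y * locKernel m ϖ a n x y * ϖ y| = |f y * ϖ y| * |locKernel m ϖ a n x y| := by
        rw [← abs_mul]
        ring_nf
    _ ≤ _ := mul_le_mul_of_nonneg_left h1 (abs_nonneg _)

/-- Subtract the reproducing formulas at `x₁` and `x₂` and apply `Assertion2`. One doubling replaces
the mixed normalization by the ball about `x₂`, which costs the factor `L`. The radius `δ` precedes
`κ`, as it does in `Assertion2`. -/
theorem IsLocalizable.exists_hasLocalOscillation (hϖ : IsLocalizable ρ m ϖ a)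
    (hΩ : IsHomogeneousDomain ρ m) (ha : IsCutoffA a) :
    ∃ δ : ℝ, 0 < δ ∧ ∀ κ : ℕ, 0 < κ → ∃ c : ℝ, 0 < c ∧ ∀ n : ℕ, 1 ≤ n → ∀ f ∈ polySpace Ω n,
      @HasLocalOscillation Ω ρ.toPseudoMetricSpace _ (weightMeasure m ϖ) κ n c δ f := by
  let := ρ.toPseudoMetricSpace
  have hW := hϖ.doublingWeight
  have := isFiniteMeasure_weightMeasure hW.integrable
  have hW0 := weightMeasure_ne_zero hW.integrable hW.nonneg hW.integral_pos
  obtain ⟨L, hL, hd⟩ := hW.exists_isDoublingMeasure hΩ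
  have hL0 : 0 < L := by linarith
  have hIP := hϖ.innerProduct
  obtain ⟨δ, hδ, hδ1, hdiff⟩ := hϖ.assertion2
  refine ⟨δ, hδ, fun κ hκ => ?_⟩
  obtain ⟨c, hc, hker⟩ := hdiff κ (by exact_mod_cast hκ)
  refine ⟨c * L, by positivity, fun n hn f hf x₁ x₂ hx => ?_⟩
  have hn' : (0 : ℝ) < n := by exact_mod_cast hn
  have hf2 : f ∈ polySpace Ω (2 * n) := polySpace_mono (by omega) hf
  set M := (weightMeasure m ϖ).real (Metric.ball x₂ (1 / (n : ℝ))) with hM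
  have hMpos : 0 < M := hd.real_ball_pos hL0.le hW0 x₂ (one_div_pos.2 hn')
  set N := (weightMeasure m ϖ).real (Metric.ball x₁ (1 / (n : ℝ))) with hN
  have hMN : M ≤ L * N := by
    refine le_trans (measureReal_mono fun y hy => ?_) (hd x₁ _ (one_div_pos.2 hn'))
    rw [Metric.mem_ball, lt_div_iff₀ hn'] at hy
    rw [Metric.mem_ball, ← mul_div_assoc, lt_div_iff₀ hn']
    have := mul_le_mul_of_nonneg_right (dist_triangle_right y x₁ x₂) hn'.le
    linarith
  have hsqrt : M / L ≤ √N * √M := by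
    have h1 : M / L ≤ N := by rwa [div_le_iff₀' hL0]
    have h2 : M / L ≤ M := div_le_self hMpos.le hL
    calc M / L = √(M / L) * √(M / L) := (Real.mul_self_sqrt (by positivity)).symm
      _ ≤ _ := mul_le_mul (Real.sqrt_le_sqrt h1) (Real.sqrt_le_sqrt h2) (Real.sqrt_nonneg _)
        (Real.sqrt_nonneg _)
  set s := (n : ℝ) * dist x₁ x₂ with hs
  have hs0 : 0 ≤ s := by positivity
  have hpt : ∀ y, |locKernel m ϖ a n x₁ y - locKernel m ϖ a n x₂ y| ≤
      c * L * s / M * (1 / (1 + n * dist x₂ y) ^ κ) := by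
    intro y
    have hmem : x₁ ∈ dBall ρ x₂ (δ / n) := by
      change dist x₂ x₁ < δ / n
      rwa [lt_div_iff₀ hn', dist_comm, mul_comm]
    refine (hker n hn δ hδ le_rfl x₁ x₂ y hmem).trans ?_
    rw [← hW.real_ball_eq hΩ, ← hW.real_ball_eq hΩ, Real.rpow_natCast]
    change c * s / (√N * √M * (1 + n * dist x₂ y) ^ κ) ≤ _
    have hpos : 0 < (1 + n * dist x₂ y) ^ κ := by positivity
    calc c * s / (√N * √M * (1 + n * dist x₂ y) ^ κ)
        ≤ c * s / (M / L * (1 + n * dist x₂ y) ^ κ) := by gcongr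
      _ = _ := by field_simp
  have hfϖ : Integrable f (weightMeasure m ϖ) :=
    (integrable_weightMeasure hW.integrable hW.nonneg f).2 (hIP.integrable_weight_mul hf)
  have hrep : ∀ x, f x = ∫ y, f y * locKernel m ϖ a n x y ∂(weightMeasure m ϖ) := by
    intro x
    rw [integral_weightMeasure hW.integrable hW.nonneg]
    exact (hIP.wInner_locKernel ha hn x n le_rfl hf).symm
  have hint : ∀ x, Integrable (fun y => f y * locKernel m ϖ a n x y) (weightMeasure m ϖ) :=
    fun x => (integrable_weightMeasure hW.integrable hW.nonneg _).2
      (hIP.integrable_mul hf2 (hIP.locKernel_mem a n x))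
  rw [hrep x₁, hrep x₂, ← integral_sub (hint x₁) (hint x₂)]
  refine abs_integral_le_integral_abs.trans ?_
  refine (integral_mono ((hint x₁).sub (hint x₂)).abs
    ((integrable_abs_div_pow hΩ.measurableSet_metricBall hfϖ hn' κ x₂).const_mul
      (c * L * s / M)) fun y => ?_).trans (le_of_eq ?_)
  · calc |f y * locKernel m ϖ a n x₁ y - f y * locKernel m ϖ a n x₂ y|
        = |f y| * |locKernel m ϖ a n x₁ y - locKernel m ϖ a n x₂ y| := by
          rw [← mul_sub, abs_mul]
      _ ≤ |f y| * (c * L * s / M * (1 / (1 + n * dist x₂ y) ^ κ)) :=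
          mul_le_mul_of_nonneg_left (hpt y) (abs_nonneg _)
      _ = _ := by ring
  · rw [integral_const_mul, localMean, ← hM]
    ring

end Localizable

end LocHom

/-! ### Assembly with `t = n` and `V = Π_n`. -/

theorem mainTheorem8 {D : ℕ} {Ω : Set (Fin D → ℝ)} (ρ : MetricSpace Ω) (m : Measure Ω)
    (hΩ : LocHom.IsHomogeneousDomain ρ m)
    (a : ℝ → ℝ) (ha : LocHom.IsCutoffA a)
    (ϖ : Ω → ℝ) (hϖ : LocHom.IsLocalizable ρ m ϖ a)
    (w : Ω → ℝ) (hw : LocHom.IsDoublingWeight ρ m w) :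
    ∃ δ₀ : ℝ, 0 < δ₀ ∧ ∃ c₁ : ℝ, 0 < c₁ ∧ ∃ c₂ : ℝ, 0 < c₂ ∧
      ∀ n : ℕ, 1 ≤ n → ∀ δ : ℝ, 0 < δ → δ < δ₀ →
      ∀ Ξ : Set Ω, LocHom.IsMaximalSeparated ρ (δ / n) Ξ →
        Ξ.Finite ∧
        ∃ lam : Ω → ℝ,
          (∀ z ∈ Ξ, 0 < lam z) ∧
          (∀ f ∈ LocHom.polySpace Ω n,
            Integrable (fun x => f x * w x) m ∧
            ∫ x, f x * w x ∂m = ∑ᶠ z ∈ Ξ, lam z * f z) ∧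
          (∀ z ∈ Ξ, c₁ * LocHom.wMass m w (LocHom.dBall ρ z (δ / n)) ≤ lam z) ∧
          (LocHom.Assertion4 ρ →
            ∀ z ∈ Ξ, lam z ≤ c₂ * LocHom.wMass m w (LocHom.dBall ρ z (δ / n))) := by
  let := ρ.toPseudoMetricSpace
  have hW := hϖ.doublingWeight
  have := LocHom.isFiniteMeasure_weightMeasure hW.integrable
  have := LocHom.isFiniteMeasure_weightMeasure hw.integrable
  have hϖ0 := LocHom.weightMeasure_ne_zero hW.integrable hW.nonneg hW.integral_pos
  have hw0 := LocHom.weightMeasure_ne_zero hw.integrable hw.nonneg hw.integral_pos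
  have hball := hΩ.measurableSet_metricBall
  obtain ⟨L₁, hL₁, hd₁⟩ := hW.exists_isDoublingMeasure hΩ
  obtain ⟨L₂, hL₂, hd₂⟩ := hw.exists_isDoublingMeasure hΩ
  set L := max L₁ L₂
  have hL : 1 ≤ L := hL₁.trans (le_max_left _ _)
  have hL0 : 0 < L := by linarith
  replace hd₁ := hd₁.mono (le_max_left L₁ L₂)
  replace hd₂ := hd₂.mono (le_max_right L₁ L₂)
  obtain ⟨κ, hκ⟩ := pow_unbounded_of_one_lt (2 * L ^ 4) (one_lt_two (α := ℝ))
  have hκ0 : 0 < κ := by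
    rcases Nat.eq_zero_or_pos κ with rfl | h
    · have := one_le_pow₀ (n := 4) hL
      norm_num at hκ
      linarith
    · exact h
  obtain ⟨δs, hδs, hosc⟩ := hϖ.exists_hasLocalOscillation hΩ ha
  obtain ⟨c, hc, hosc⟩ := hosc κ hκ0
  obtain ⟨δ₀, hδ₀, hquad⟩ := LocHom.exists_positive_quadrature hball hd₁ hd₂ hL hϖ0 hw0
    hκ.le hc hδs
  refine ⟨δ₀, hδ₀, 1 / (2 * L), by positivity, 3 / 2, by norm_num, ?_⟩
  intro n hn δ hδ hδlt Ξ hΞ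
  have hn' : (0 : ℝ) < n := by exact_mod_cast hn
  have hsep : Ξ.Pairwise fun x y => δ / n ≤ dist x y := fun x hx y hy hne =>
    hΞ.separated x hx y hy hne
  have hfin : Ξ.Finite := hd₁.finite_of_separated hL0 hϖ0 hball (div_pos hδ hn') hsep
  obtain ⟨Z, rfl⟩ := hfin.exists_finset_coe
  have hcov : ∀ x, ∃ z ∈ Z, dist x z < δ / n := by
    intro x
    obtain ⟨_, -, hmax⟩ := hΞ.maximal
    obtain ⟨z, hz, hxz⟩ := Set.one_le_encard_iff_nonempty.1 (hmax x).1
    refine ⟨z, hz, ?_⟩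
    rw [dist_comm]
    exact hxz
  have hint : ∀ f ∈ LocHom.polySpace Ω n, Integrable (fun x => f x * w x) m := by
    intro f hf
    -- Integrability against `w` comes from boundedness of `f`, since the inner product controls
    -- only integrals against `ϖ`.
    obtain ⟨B, hB⟩ := hϖ.exists_abs_le hΩ ha hn hf
    exact hw.integrable.bdd_mul
      (LocHom.measurable_of_mem_polySpace hf).aestronglyMeasurable (ae_of_all _ hB)
  obtain ⟨lam, hlam, hbound⟩ := hquad n hn' (LocHom.polySpace Ω n) (fun f hf =>
    ⟨(LocHom.integrable_weightMeasure hW.integrable hW.nonneg f).2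
      (hϖ.innerProduct.integrable_weight_mul hf),
      (LocHom.integrable_weightMeasure hw.integrable hw.nonneg f).2 (hint f hf),
      hosc n hn f hf⟩) δ hδ hδlt Z hsep hcov
  refine ⟨hfin, lam, fun z hz => ?_, fun f hf => ⟨hint f hf, ?_⟩, fun z hz => ?_,
    fun _ z hz => ?_⟩
  · have := hd₂.real_ball_pos hL0.le hw0 z (div_pos hδ hn')
    exact lt_of_lt_of_le (by positivity) (hbound z hz).1
  · rw [← LocHom.integral_weightMeasure hw.integrable hw.nonneg, hlam f hf,
      finsum_mem_coe_finset]
  · rw [← hw.real_ball_eq hΩ]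
    exact (hbound z hz).1
  · rw [← hw.real_ball_eq hΩ]
    exact (hbound z hz).2
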